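/- For a graph $G$ on $n$ vertices with Laplacian matrix $L(G)$, define its Laplacian coefficients $c_k(G)$ by $\det(\lambda I_n-L(G))=\sum_{k=0}^n(-1)^kc_k(G)\lambda^{n-k}$. For graphs $G,H$ of the same order $n$, write $G\preceq H$ if $c_k(G)\le c_k(H)$ for all $0\le k\le n$. For $g\ge 3$ and rooted trees $T_1,\dots,T_g$, let $C_{T_1,\dots,T_g}$ be the unicyclic graph obtained from the cycle $u_1u_2\cdots u_g$ by attaching $T_i$ at $u_i$, i.e. identifying the root of $T_i$ with $u_i$, for each $i$. For $m>l\ge 1$, let $BST_{m,l}$ be the balanced starlike tree of order $m$ obtained from $l$ paths, each of order $\lfloor\frac{m-1}{l}\rfloor+1$ or $\lceil\frac{m-1}{l}\rceil+1$, by identifying one end of each of them; the common vertex is its center. Let $BST_{1,0}$ be a single vertex. **Theorem.** Let $T_1,\dots,T_g$ ($g\ge3$) be finite rooted trees, where $T_i$ has $n_i$ vertices and $l_i$ leaves (the vertices of degree one in $T_i$ other than the root, so that $l_i$ is the number of leaves of $C_{T_1,\dots,T_g}$ lying in $T_i$). Then there are integers $p_1,\dots,p_g$ with $1\le p_i\le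 n_i-l_i$, all equal to $1$ except at most one, such that $$C_{B_1,\dots,B_g}\preceq C_{T_1,\dots,T_g},$$ where $B_i$ is the rooted tree obtained from a path of order $p_i$ (length $p_i-1$) and $BST_{n_i-p_i+1,\,l_i}$ by identifying one end of the path with the center of $BST_{n_i-p_i+1,\,l_i}$, the root of $B_i$ being the other end of the path (the center itself if $p_i=1$). Moreover, equality holds, i.e. $c_k(C_{B_1,\dots,B_g})=c_k(C_{T_1,\dots,T_g})$ for all $0\le k\le n_1+\cdots+n_g$, if and only if $C_{B_1,\dots,B_g}\cong C_{T_1,\dots,T_g}$. -/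

import Mathlib

noncomputable section

open Classical in
/-- The Laplacian coefficient `c_k(G)` of a finite graph `G` with `n` vertices (meant for
`0 ≤ k ≤ n`), defined by `det (λ I - L(G)) = ∑_{k = 0}^{n} (-1)^k c_k(G) λ^(n-k)`. -/
def lapCoeff {V : Type*} [Fintype V] (G : SimpleGraph V) (k : ℕ) : ℤ :=
  (-1) ^ k * (G.lapMatrix ℤ).charpoly.coeff (Fintype.card V - k)

/-- `G ⪯ H`: the graphs have the same order `n`, and `c_k(G) ≤ c_k(H)` for all `0 ≤ k ≤ n`. -/
def LapLE {V W : Type*} [Fintype V] [Fintype W] (G : SimpleGraph V) (H : SimpleGraph W) : Prop :=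
  Fintype.card V = Fintype.card W ∧ ∀ k ≤ Fintype.card V, lapCoeff G k ≤ lapCoeff H k

/-- The number of leaves of the tree `T` rooted at `r`: vertices of degree one other than the
root. -/
def leafCount {V : Type*} (T : SimpleGraph V) (r : V) : ℕ :=
  {v : V | v ≠ r ∧ (T.neighborSet v).ncard = 1}.ncard

/-- The graph `C_{T_1, …, T_g}` obtained from the cycle `u_1 ⋯ u_g` by attaching the graph
`T_i` at its root `r_i = u_i`, for every `i`. -/
def cycleAttach {g : ℕ} {V : Fin g → Type*} (T : ∀ i, SimpleGraph (V i)) (r : ∀ i, V i) :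
    SimpleGraph (Σ i, V i) where
  Adj x y :=
    (∃ i a b, (T i).Adj a b ∧ x = ⟨i, a⟩ ∧ y = ⟨i, b⟩) ∨
    (∃ i j, (SimpleGraph.cycleGraph g).Adj i j ∧ x = ⟨i, r i⟩ ∧ y = ⟨j, r j⟩)
  symm := ⟨by
    rintro x y (⟨i, a, b, h, rfl, rfl⟩ | ⟨i, j, h, rfl, rfl⟩)
    · exact Or.inl ⟨i, b, a, h.symm, rfl, rfl⟩
    · exact Or.inr ⟨j, i, h.symm, rfl, rfl⟩⟩
  loopless := ⟨by
    rintro x (⟨i, a, b, h, rfl, hb⟩ | ⟨i, j, h, rfl, hj⟩)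
    · obtain rfl : a = b := by simpa using hb
      exact h.ne rfl
    · obtain rfl : i = j := congrArg Sigma.fst hj
      exact h.ne rfl⟩

/-- The vertices of a starlike tree with a center and `l` legs, the `j`-th leg having `a j`
vertices besides the center: `none` is the center, and `some ⟨j, k⟩` is the vertex of the
`j`-th leg at distance `k + 1` from the center. -/
abbrev StarVert {l : ℕ} (a : Fin l → ℕ) : Type := Option (Σ j : Fin l, Fin (a j))

/-- The starlike tree obtained by identifying one end of each of `l` paths, of orders
`a 0 + 1, …, a (l - 1) + 1`. -/
def starlike {l : ℕ} (a : Fin l → ℕ) : SimpleGraph (StarVert a) :=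
  SimpleGraph.fromRel fun x y =>
    match x, y with
    | none, some ⟨_, k⟩ => k.val = 0
    | some ⟨j, k⟩, some ⟨j', k'⟩ => j = j' ∧ k'.val = k.val + 1
    | _, _ => False

/-- The leg lengths of the balanced starlike tree of order `m` with `l` leaves: each of them is
`⌊(m - 1) / l⌋` or `⌈(m - 1) / l⌉`, and they add up to `m - 1`. -/
def legLength (m l : ℕ) (j : Fin l) : ℕ :=
  (m - 1) / l + if j.val < (m - 1) % l then 1 else 0

theorem sum_legLength (m l : ℕ) (hl : 0 < l) : ∑ j, legLength m l j = m - 1 := by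
  have h : (Finset.univ.filter fun j : Fin l => j.val < (m - 1) % l).card = (m - 1) % l := by
    rw [Fin.card_filter_val_lt]
    exact min_eq_right (Nat.mod_lt _ hl).le
  simp only [legLength, Finset.sum_add_distrib, Finset.sum_const, Finset.card_univ,
    Fintype.card_fin, smul_eq_mul, ← Finset.card_filter, h]
  exact Nat.div_add_mod _ _

theorem legLength_eq (m l : ℕ) (j : Fin l) :
    legLength m l j = ⌊((m - 1 : ℕ) : ℚ) / l⌋₊ ∨ legLength m l j = ⌈((m - 1 : ℕ) : ℚ) / l⌉₊ := by
  have hl : 0 < l := j.pos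
  unfold legLength
  split_ifs with h
  · right
    symm
    have hq : (0 : ℚ) < l := by exact_mod_cast hl
    have hd := Nat.div_add_mod (m - 1) l
    have hm := Nat.mod_lt (m - 1) hl
    rw [Nat.ceil_eq_iff (Nat.succ_ne_zero _), lt_div_iff₀ hq, div_le_iff₀ hq]
    rw [Nat.succ_sub_one]
    constructor
    · norm_cast
      nlinarith
    · norm_cast
      nlinarith
  · left
    simp [Nat.floor_div_natCast]

/-- The balanced starlike tree `BST_{m,l}` of order `m` with `l` leaves, with center `none`
(meant for `1 ≤ l < m`, and for `m = 1`, `l = 0`, where it is a single vertex). -/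
def BST (m l : ℕ) : SimpleGraph (StarVert (legLength m l)) := starlike (legLength m l)

theorem card_BST (m l : ℕ) (hl : 0 < l) (hm : 0 < m) :
    Fintype.card (StarVert (legLength m l)) = m := by
  simp [StarVert, sum_legLength m l hl]
  omega

/-- The graph obtained by identifying the last vertex of a path with `q` edges with the vertex
`c` of `H`. The vertices `Sum.inl 0, …, Sum.inl (q - 1)` are the other vertices of the path,
in order. -/
def prependPath {W : Type*} (q : ℕ) (H : SimpleGraph W) (c : W) : SimpleGraph (Fin q ⊕ W) :=
  SimpleGraph.fromRel fun x y =>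
    match x, y with
    | .inl i, .inl j => j.val = i.val + 1
    | .inl i, .inr w => i.val + 1 = q ∧ w = c
    | .inr w, .inr w' => H.Adj w w'
    | _, _ => False

/-- The first vertex of the path in `prependPath q H c`; it is `c` itself if `q = 0`. -/
def prependPathRoot {W : Type*} (q : ℕ) (c : W) : Fin q ⊕ W :=
  if h : 0 < q then .inl ⟨0, h⟩ else .inr c

/-- The vertices of the rooted tree `B` with parameters `n, l, p`. -/
abbrev BVert (n l p : ℕ) : Type := Fin (p - 1) ⊕ StarVert (legLength (n - p + 1) l)

/-- The tree obtained by identifying one end of a path `P_p` of order `p` (and length `p - 1`)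
with the center of `BST_{n-p+1,l}` (meant for `1 ≤ p` and `p + l ≤ n`). -/
def BTree (n l p : ℕ) : SimpleGraph (BVert n l p) := prependPath (p - 1) (BST (n - p + 1) l) none

/-- The root of `BTree n l p`: the other end of the path `P_p`. -/
def BRoot (n l p : ℕ) : BVert n l p := prependPathRoot (p - 1) none

theorem card_BVert (n l p : ℕ) (hl : 0 < l) (hp : 1 ≤ p) (h : p + l ≤ n) :
    Fintype.card (BVert n l p) = n := by
  rw [Fintype.card_sum, card_BST _ _ hl (by omega), Fintype.card_fin]
  omega

end

/-! Write `φ = det (x + L)`. Its coefficients are the Laplacian coefficients without signs, so it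
suffices to compare these polynomials coefficientwise. A rooted graph with root minor `h` is encoded
by the pair `(φ - x h, h)`. The ratio of the two components adds up when roots are identified
(`glue`), and hanging from a new root (`hang`) acts on pairs by a matrix of determinant one. The
determinant `crossPath p k` therefore compares a rooted graph with a path of `k` edges, and it is
nonnegative for every tree of height at least `k`, strictly so unless the tree is a path
(`crossPath_pair_nonneg`, `crossPath_pair_pos_of_not_isPath`).

Two moves preserve the numbers of vertices and leaves and lower `φ` by an explicit product. If a
vertex below the root of `A` has a path among its branches, all its other branches move up to its
parent; the gain is (first component of the moved part) times (cross of the rest with a path). If a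
vertex has a path branch shorter than another branch, everything else attached there slides one step
along the longer branch. Inside one tree these moves apply until a stem followed by a balanced star
remains (`isBalanced_or_reducible`). If two trees have a stem, the first move also applies to the
one of smaller height, since the taller tree, seen through the cycle, dominates all the paths that
matter (`dominates_cyclePair`). Every move strictly decreases the integer `φ(1) > 0`, so the process
stops (`exists_balanced_family`). It ends at the given family or at a strictly smaller polynomial,
which settles the equality case.

What remains is to identify the algebra with graphs. The determinant lemma reduces a cycle with
attached trees to a weighted cycle Laplacian, and deletion and contraction of edges evaluate the
latter (`lapPoly_cycleAttach`, `prod_mul_det_cycleMatrix`). Finite rooted trees are matched with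
`RForest`, and balanced forests with `BTree`. -/

open Polynomial

/-! ### Coefficientwise order on integer polynomials. -/

/-- All coefficients are nonnegative. -/
def CoeffNonneg (p : ℤ[X]) : Prop := ∀ n, 0 ≤ p.coeff n

/-- All coefficients are nonnegative, and some coefficient is positive. -/
def CoeffPos (p : ℤ[X]) : Prop := CoeffNonneg p ∧ p ≠ 0

theorem CoeffPos.nonneg {p : ℤ[X]} (hp : CoeffPos p) : CoeffNonneg p := hp.1

theorem CoeffNonneg.zero : CoeffNonneg 0 := fun n => by simp

theorem CoeffNonneg.add {p q : ℤ[X]} (hp : CoeffNonneg p) (hq : CoeffNonneg q) :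
    CoeffNonneg (p + q) := fun n => by
  rw [coeff_add]; exact add_nonneg (hp n) (hq n)

theorem CoeffNonneg.mul {p q : ℤ[X]} (hp : CoeffNonneg p) (hq : CoeffNonneg q) :
    CoeffNonneg (p * q) := fun n => by
  rw [coeff_mul]; exact Finset.sum_nonneg fun _ _ => mul_nonneg (hp _) (hq _)

theorem CoeffPos.one : CoeffPos 1 := by
  refine ⟨fun n => ?_, one_ne_zero⟩
  rw [coeff_one]; split_ifs <;> simp

theorem CoeffPos.X : CoeffPos X := by
  refine ⟨fun n => ?_, X_ne_zero⟩
  rw [coeff_X]; split_ifs <;> simp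

theorem CoeffPos.mul {p q : ℤ[X]} (hp : CoeffPos p) (hq : CoeffPos q) : CoeffPos (p * q) :=
  ⟨hp.1.mul hq.1, mul_ne_zero hp.2 hq.2⟩

theorem CoeffPos.add_nonneg {p q : ℤ[X]} (hp : CoeffPos p) (hq : CoeffNonneg q) :
    CoeffPos (p + q) := by
  refine ⟨hp.1.add hq, fun h => hp.2 ?_⟩
  ext n
  have := congrArg (fun r => coeff r n) h
  simp only [coeff_add, coeff_zero] at this ⊢
  have h1 := hp.1 n
  have h2 := hq n
  omega

theorem CoeffNonneg.add_pos {p q : ℤ[X]} (hp : CoeffNonneg p) (hq : CoeffPos q) :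
    CoeffPos (p + q) := add_comm q p ▸ hq.add_nonneg hp

theorem CoeffPos.add {p q : ℤ[X]} (hp : CoeffPos p) (hq : CoeffPos q) : CoeffPos (p + q) :=
  hp.add_nonneg hq.1

/-- A strict coefficientwise inequality becomes a strict inequality of integers at `1`; this
supplies the measure for termination. -/
theorem CoeffPos.eval_one {p : ℤ[X]} (hp : CoeffPos p) : 0 < p.eval 1 := by
  rw [eval_eq_sum_range]
  refine Finset.sum_pos' (fun i _ => by simpa using hp.1 i)
    ⟨p.natDegree, by simp, ?_⟩
  have h1 := hp.1 p.natDegree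
  have h2 : p.coeff p.natDegree ≠ 0 := by simpa using hp.2
  simp only [one_pow, mul_one]
  omega

/-! ### Pairs of rooted graphs and rooted forests. -/

/-- A rooted graph is represented by the pair `(φ - x h, h)`, where `φ = det (x + L)` and `h` is
the minor of `x + L` in which the root is deleted. This is the value of `φ`. -/
noncomputable def pairVal (p : ℤ[X] × ℤ[X]) : ℤ[X] := X * p.2 + p.1

/-- The pair of the graph obtained by identifying the roots of two rooted graphs. -/
def glue {R : Type*} [CommRing R] (p q : R × R) : R × R := (p.1 * q.2 + p.2 * q.1, p.2 * q.2)

/-- The pair of the graph obtained by joining a rooted graph to a new root by an edge. -/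
noncomputable def hang (p : ℤ[X] × ℤ[X]) : ℤ[X] × ℤ[X] := (pairVal p, pairVal p + p.2)

theorem glue_comm {R : Type*} [CommRing R] (p q : R × R) : glue p q = glue q p := by
  ext : 1 <;> simp only [glue] <;> ring

theorem glue_assoc {R : Type*} [CommRing R] (p q r : R × R) :
    glue (glue p q) r = glue p (glue q r) := by
  ext : 1 <;> simp only [glue] <;> ring

theorem glue_left_comm {R : Type*} [CommRing R] (p q r : R × R) :
    glue p (glue q r) = glue q (glue p r) := by
  ext : 1 <;> simp only [glue] <;> ring

theorem glue_unit {R : Type*} [CommRing R] (p : R × R) : glue p (0, 1) = p := by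
  ext : 1 <;> simp [glue]

theorem unit_glue {R : Type*} [CommRing R] (p : R × R) : glue (0, 1) p = p := by
  ext : 1 <;> simp [glue]

/-- Both sides describe two graphs joined by an edge between their roots, seen from either end. This
identity moves the root along an edge. -/
theorem pairVal_glue_hang (p q : ℤ[X] × ℤ[X]) :
    pairVal (glue p (hang q)) = pairVal (glue (hang p) q) := by
  simp only [pairVal, glue, hang]; ring

/-- A finite ordered rooted forest: either empty, or given by the forest of the children of the
first root and the forest of the other trees. It also represents the rooted tree in which all the
roots of the forest are joined to a new root. -/
inductive RForest : Type
  | nil : RForest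
  | cons (c s : RForest) : RForest

namespace RForest

/-- The number of vertices of the forest. -/
def size : RForest → ℕ
  | nil => 0
  | cons c s => c.size + 1 + s.size

/-- The number of vertices without children. -/
def leaves : RForest → ℕ
  | nil => 0
  | cons c s => max 1 c.leaves + s.leaves

/-- The height of the rooted tree represented by the forest. -/
def height : RForest → ℕ
  | nil => 0
  | cons c s => max (c.height + 1) s.height

/-- The pair of the rooted tree represented by the forest. -/
noncomputable def pair : RForest → ℤ[X] × ℤ[X]
  | nil => (0, 1)
  | cons c s => glue (hang c.pair) s.pair

/-- The path with `k` edges, rooted at one end. -/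
def path : ℕ → RForest
  | 0 => nil
  | k + 1 => cons (path k) nil

/-- The disjoint union of two forests. -/
def append : RForest → RForest → RForest
  | nil, t => t
  | cons c s, t => cons c (append s t)

/-- The trees of the forest, each given by the forest of the children of its root. -/
def trees : RForest → List RForest
  | nil => []
  | cons c s => c :: s.trees

/-- The forest of a given list of trees. -/
def ofTrees : List RForest → RForest
  | [] => nil
  | c :: l => cons c (ofTrees l)

/-- The rooted tree is a path rooted at one end. -/
def IsPath (f : RForest) : Prop := ∃ k, f = path k

theorem ofTrees_trees (f : RForest) : ofTrees f.trees = f := by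
  induction f with
  | nil => rfl
  | cons c s _ ih => simp [trees, ofTrees, ih]

theorem size_append (s t : RForest) : (s.append t).size = s.size + t.size := by
  induction s with
  | nil => simp [append, size]
  | cons c s _ ih => simp [append, size, ih, add_assoc]

theorem leaves_append (s t : RForest) : (s.append t).leaves = s.leaves + t.leaves := by
  induction s with
  | nil => simp [append, leaves]
  | cons c s _ ih => simp [append, leaves, ih, add_assoc]

theorem pair_append (s t : RForest) : (s.append t).pair = glue s.pair t.pair := by
  induction s with
  | nil => simp [append, pair, unit_glue]
  | cons c s _ ih => simp [append, pair, ih, glue_assoc]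

theorem leaves_pos {f : RForest} (h : f ≠ nil) : 1 ≤ f.leaves := by
  cases f with
  | nil => exact absurd rfl h
  | cons c s => simp only [leaves]; omega

theorem leaves_path (k : ℕ) : (path k).leaves ≤ 1 := by
  induction k with
  | zero => simp [path, leaves]
  | succ k ih => simp only [path, leaves]; omega

theorem height_path (k : ℕ) : (path k).height = k := by
  induction k with
  | zero => simp [path, height]
  | succ k ih => simp only [path, height, ih]; omega

theorem isPath_nil : IsPath nil := ⟨0, rfl⟩

theorem IsPath.cons_nil {c : RForest} (h : c.IsPath) : IsPath (cons c nil) := by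
  obtain ⟨k, rfl⟩ := h
  exact ⟨k + 1, rfl⟩

theorem pair_snd_pos_fst_nonneg (f : RForest) : CoeffPos f.pair.2 ∧ CoeffNonneg f.pair.1 := by
  induction f with
  | nil => exact ⟨CoeffPos.one, CoeffNonneg.zero⟩
  | cons c s hc hs =>
    have hv : CoeffPos (pairVal c.pair) := (CoeffPos.X.mul hc.1).add_nonneg hc.2
    simp only [pair, glue, hang]
    exact ⟨(hv.add hc.1).mul hs.1, (hv.mul hs.1).1.add ((hv.add hc.1).1.mul hs.2)⟩

theorem pair_snd_pos (f : RForest) : CoeffPos f.pair.2 := f.pair_snd_pos_fst_nonneg.1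

theorem pair_fst_nonneg (f : RForest) : CoeffNonneg f.pair.1 := f.pair_snd_pos_fst_nonneg.2

end RForest

theorem pairVal_pos {p : ℤ[X] × ℤ[X]} (h2 : CoeffPos p.2) (h1 : CoeffNonneg p.1) :
    CoeffPos (pairVal p) := (CoeffPos.X.mul h2).add_nonneg h1

namespace RForest

theorem pairVal_pos (f : RForest) : CoeffPos (pairVal f.pair) :=
  _root_.pairVal_pos f.pair_snd_pos f.pair_fst_nonneg

theorem pair_fst_pos {f : RForest} (h : f ≠ nil) : CoeffPos f.pair.1 := by
  cases f with
  | nil => exact absurd rfl h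
  | cons c s =>
    simp only [pair, glue, hang]
    exact (c.pairVal_pos.mul s.pair_snd_pos).add_nonneg
      ((c.pairVal_pos.add c.pair_snd_pos).1.mul s.pair_fst_nonneg)

end RForest

/-! ### Comparison with paths. -/

/-- Comparison of a rooted graph with the path with `k` edges. -/
noncomputable def crossPath (p : ℤ[X] × ℤ[X]) (k : ℕ) : ℤ[X] :=
  p.1 * (RForest.path k).pair.2 - p.2 * (RForest.path k).pair.1

theorem crossPath_zero (p : ℤ[X] × ℤ[X]) : crossPath p 0 = p.1 := by
  simp [crossPath, RForest.path, RForest.pair]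

/-- Hanging acts on pairs by the matrix with rows `(1, x)` and `(1, 1 + x)`, of determinant `1`, and
it acts on the path at the same time. -/
theorem crossPath_hang_succ (p : ℤ[X] × ℤ[X]) (k : ℕ) :
    crossPath (hang p) (k + 1) = crossPath p k := by
  simp only [crossPath, RForest.path, RForest.pair, glue_unit, hang, pairVal]; ring

theorem crossPath_glue (p q : ℤ[X] × ℤ[X]) (k : ℕ) :
    crossPath (glue p q) k =
      q.2 * crossPath p k + p.2 * q.1 * (RForest.path k).pair.2 := by
  simp only [crossPath, glue]; ring

theorem crossPath_glue' (p q : ℤ[X] × ℤ[X]) (k : ℕ) :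
    crossPath (glue p q) k =
      p.2 * crossPath q k + q.2 * p.1 * (RForest.path k).pair.2 := by
  simp only [crossPath, glue]; ring

namespace RForest

/-- A branch that attains the height loses one edge together with the path; the other branches only
contribute nonnegative terms. -/
theorem crossPath_pair_nonneg (f : RForest) {k : ℕ} (hk : k ≤ f.height) :
    CoeffNonneg (crossPath f.pair k) := by
  induction f generalizing k with
  | nil =>
    obtain rfl : k = 0 := by simpa [height] using hk
    rw [crossPath_zero]
    exact pair_fst_nonneg _
  | cons c s hc hs =>
    cases k with
    | zero => rw [crossPath_zero]; exact pair_fst_nonneg _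
    | succ k =>
      simp only [height, le_max_iff, add_le_add_iff_right] at hk
      rcases hk with hk | hk
      · rw [pair, crossPath_glue, crossPath_hang_succ]
        exact (s.pair_snd_pos.1.mul (hc hk)).add
          (((c.pairVal_pos.add c.pair_snd_pos).1.mul s.pair_fst_nonneg).mul (pair_snd_pos _).1)
      · rw [pair, crossPath_glue']
        exact ((c.pairVal_pos.add c.pair_snd_pos).1.mul (hs hk)).add
          ((s.pair_snd_pos.mul c.pairVal_pos).mul (pair_snd_pos _)).1

/-- A tree that is not a path branches somewhere, and a second branch contributes a strictly
positive term. -/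
theorem crossPath_pair_pos_of_not_isPath (f : RForest) {k : ℕ} (hk : k ≤ f.height)
    (hf : ¬ f.IsPath) : CoeffPos (crossPath f.pair k) := by
  induction f generalizing k with
  | nil => exact absurd isPath_nil hf
  | cons c s hc hs =>
    cases k with
    | zero => rw [crossPath_zero]; exact pair_fst_pos (by simp)
    | succ k =>
      simp only [height, le_max_iff, add_le_add_iff_right] at hk
      rcases hk with hk | hk
      · rw [pair, crossPath_glue, crossPath_hang_succ]
        by_cases h : s = nil
        · subst h
          exact (pair_snd_pos _).mul (hc hk fun h => hf h.cons_nil) |>.add_nonneg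
            (((c.pairVal_pos.add c.pair_snd_pos).1.mul (pair_fst_nonneg _)).mul (pair_snd_pos _).1)
        · exact (s.pair_snd_pos.1.mul (crossPath_pair_nonneg c hk)).add_pos
            (((c.pairVal_pos.add c.pair_snd_pos).mul (pair_fst_pos h)).mul (pair_snd_pos _))
      · rw [pair, crossPath_glue']
        exact ((c.pairVal_pos.add c.pair_snd_pos).1.mul (crossPath_pair_nonneg s hk)).add_pos
          ((s.pair_snd_pos.mul c.pairVal_pos).mul (pair_snd_pos _))

/-- Peeling `k` edges from both paths leaves a path of positive length against a single vertex. -/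
theorem crossPath_pair_path_pos {b k : ℕ} (hk : k < b) :
    CoeffPos (crossPath (path b).pair k) := by
  induction k generalizing b with
  | zero =>
    rw [crossPath_zero]
    obtain ⟨b, rfl⟩ := Nat.exists_eq_succ_of_ne_zero hk.ne'
    exact pair_fst_pos (by simp [path])
  | succ k ih =>
    obtain ⟨b, rfl⟩ := Nat.exists_eq_succ_of_ne_zero (Nat.ne_zero_of_lt hk)
    rw [path, pair, pair, glue_unit, crossPath_hang_succ]
    exact ih (by omega)

end RForest

/-! ### The two decreasing moves inside one tree. -/

namespace RForest

/-- The two forests agree in all the quantities that do not depend on the order of the trees. -/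
structure Similar (f g : RForest) : Prop where
  pair : f.pair = g.pair
  size : f.size = g.size
  leaves : f.leaves = g.leaves
  height : f.height = g.height

theorem similar_ofTrees_of_perm {l l' : List RForest} (h : l.Perm l') :
    Similar (ofTrees l) (ofTrees l') := by
  induction h with
  | nil => exact ⟨rfl, rfl, rfl, rfl⟩
  | cons x _ ih =>
    exact ⟨by simp only [ofTrees, RForest.pair, ih.pair],
      by simp only [ofTrees, RForest.size, ih.size],
      by simp only [ofTrees, RForest.leaves, ih.leaves],
      by simp only [ofTrees, RForest.height, ih.height]⟩
  | swap x y l =>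
    refine ⟨?_, ?_, ?_, ?_⟩
    · simp only [ofTrees, RForest.pair, glue_left_comm]
    · simp only [ofTrees, RForest.size]; omega
    · simp only [ofTrees, RForest.leaves]; omega
    · simp only [ofTrees, RForest.height]; omega
  | trans _ _ h1 h2 =>
    exact ⟨h1.pair.trans h2.pair, h1.size.trans h2.size, h1.leaves.trans h2.leaves,
      h1.height.trans h2.height⟩

theorem exists_perm_cons_of_mem {α : Type*} {a : α} {l : List α} (h : a ∈ l) :
    ∃ l', l.Perm (a :: l') := by
  obtain ⟨s, t, rfl⟩ := List.append_of_mem h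
  exact ⟨s ++ t, List.perm_middle⟩

theorem exists_similar_cons_of_perm {f : RForest} {c : RForest} {l : List RForest}
    (h : f.trees.Perm (c :: l)) : Similar f (cons c (ofTrees l)) := by
  have := similar_ofTrees_of_perm h
  rwa [ofTrees_trees] at this

theorem ofTrees_ne_nil {l : List RForest} (h : l ≠ []) : ofTrees l ≠ nil := by
  cases l with
  | nil => exact absurd rfl h
  | cons c l => simp [ofTrees]

theorem pair_path_succ (k : ℕ) : (path (k + 1)).pair = hang (path k).pair := by
  rw [path, pair, pair, glue_unit]

/-- Moving all branches but one, a path, from a vertex to its parent. -/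
theorem exists_pairVal_lt_of_crossPath_pos {A : ℤ[X] × ℤ[X]} {t : RForest} (ht : ¬ t.IsPath)
    (hA2 : CoeffPos A.2) (hA1 : CoeffNonneg A.1)
    (hA : ∀ k ≤ t.height, CoeffPos (crossPath A k)) :
    ∃ s : RForest, s.size = t.size + 1 ∧ s.leaves = max 1 t.leaves ∧
      CoeffPos (pairVal (glue A (hang t.pair)) - pairVal (glue A s.pair)) := by
  induction t generalizing A with
  | nil => exact absurd isPath_nil ht
  | cons c s hc _ =>
    -- Either the root of `t` has a path branch and something else to move, or no move is made here
    -- and the argument descends into the first child.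
    by_cases hP : s ≠ nil ∧ ∃ P ∈ (cons c s).trees, IsPath P
    · obtain ⟨hs, P, hP, k, rfl⟩ := hP
      obtain ⟨l, hl⟩ : ∃ l, (cons c s).trees.Perm (path k :: l) :=
        exists_perm_cons_of_mem hP
      have hlen : l ≠ [] := by
        rintro rfl
        have := hl.length_eq
        cases s with
        | nil => exact hs rfl
        | cons c' s' => simp [trees] at this
      have hsim := exists_similar_cons_of_perm hl
      have hS : ofTrees l ≠ nil := ofTrees_ne_nil hlen
      generalize ofTrees l = S at hsim hS
      generalize cons c s = t at *
      refine ⟨cons (path (k + 1)) S, ?_, ?_, ?_⟩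
      · rw [hsim.size]; simp only [size, path]; omega
      · rw [hsim.leaves]
        have h1 := leaves_path k
        have h2 := leaves_path (k + 1)
        simp only [leaves]
        omega
      · have hk : k + 1 ≤ t.height := by
          rw [hsim.height]; simp only [height, height_path]; omega
        -- After `S` moves to the root of `A`, the edge to the old parent of `S` and the path below
        -- it form one longer branch.
        have : pairVal (glue A (hang t.pair)) - pairVal (glue A (cons (path (k + 1)) S).pair) =
            S.pair.1 * crossPath A (k + 1) := by
          rw [hsim.pair, pair, pair, ← pair_path_succ, crossPath]
          generalize (path (k + 1)).pair = q
          simp only [pairVal, glue, hang]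
          ring
        rw [this]
        exact (pair_fst_pos hS).mul (hA _ hk)
    · have hcP : ¬ c.IsPath := by
        intro h
        by_cases hs : s = nil
        · subst hs; exact ht h.cons_nil
        · exact hP ⟨hs, c, by simp [trees], h⟩
      have hv := _root_.pairVal_pos hA2 hA1
      -- Seen from the root of `t`, the graph outside `c` is `A` hung by an edge, together with `s`.
      -- Hanging raises the length of dominated paths by one, so the height bound for `t` suffices.
      have hd : ∀ k ≤ c.height, CoeffPos (crossPath (glue (hang A) s.pair) k) := by
        intro k hk
        rw [crossPath_glue]
        refine CoeffPos.add_nonneg (s.pair_snd_pos.mul ?_)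
          (((hv.add hA2).1.mul s.pair_fst_nonneg).mul (pair_snd_pos _).1)
        cases k with
        | zero => rw [crossPath_zero]; exact hv
        | succ k =>
          rw [crossPath_hang_succ]
          exact hA _ (by simp only [height]; omega)
      obtain ⟨s', h1, h2, h3⟩ := hc (A := glue (hang A) s.pair) hcP
        ((hv.add hA2).mul s.pair_snd_pos)
        ((hv.1.mul s.pair_snd_pos.1).add ((hv.add hA2).1.mul s.pair_fst_nonneg)) hd
      refine ⟨cons (s'.append s) nil, ?_, ?_, ?_⟩
      · simp only [size, size_append, h1]
      · simp only [leaves, leaves_append, h2]; omega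
      · rw [pair, pair, pair_append, pair, glue_unit, pairVal_glue_hang A (glue _ _),
          pairVal_glue_hang A (glue _ _), glue_comm s'.pair, glue_comm (hang c.pair)]
        simpa only [glue_assoc] using h3

/-- Moving the root along the second branch, if the first branch is a shorter path. -/
theorem pairVal_lt_of_crossPath_pos {B : ℤ[X] × ℤ[X]} {t : RForest} {k : ℕ}
    (hB : CoeffPos B.1) (h : CoeffPos (crossPath t.pair (k + 1))) :
    CoeffPos (pairVal (glue B (cons (path k) (cons t nil)).pair) -
      pairVal (glue B (cons (path (k + 1)) t).pair)) := by
  -- The rest `B` now sits at the root of `t`, and the old root becomes an inner vertex of the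
  -- lengthened path.
  have : pairVal (glue B (cons (path k) (cons t nil)).pair) -
      pairVal (glue B (cons (path (k + 1)) t).pair) = B.1 * crossPath t.pair (k + 1) := by
    rw [pair, pair, pair, pair, glue_unit, ← pair_path_succ, crossPath]
    generalize (path (k + 1)).pair = q
    simp only [pairVal, glue, hang]
    ring
  rw [this]
  exact hB.mul h

/-- Joining the root to a new root, `q` times. -/
def stretch : ℕ → RForest → RForest
  | 0, f => f
  | q + 1, f => cons (stretch q f) nil

/-- The forest of paths, the `j`-th one with `L j` edges. -/
def paths (L : List ℕ) : RForest := ofTrees (L.map path)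

/-- The rooted tree consists of a path and a balanced starlike tree. -/
def IsBalanced (f : RForest) : Prop :=
  ∃ q L, f = stretch q (paths L) ∧ ∀ a ∈ L, ∀ b ∈ L, a ≤ b + 1

/-- There is a rooted tree with the same number of vertices and leaves as `f` which is
smaller when its root is identified with the root of `A`. -/
def Reducible (A : ℤ[X] × ℤ[X]) (f : RForest) : Prop :=
  ∃ f' : RForest, f'.size = f.size ∧ f'.leaves = f.leaves ∧
    CoeffPos (pairVal (glue A f.pair) - pairVal (glue A f'.pair))

theorem Reducible.of_similar {A : ℤ[X] × ℤ[X]} {f g : RForest} (h : Similar f g)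
    (hg : Reducible A g) : Reducible A f := by
  obtain ⟨f', h1, h2, h3⟩ := hg
  exact ⟨f', h1.trans h.size.symm, h2.trans h.leaves.symm, by rwa [h.pair]⟩

/-- This is the first move on the branch `t`, with the sibling branches `s` counted as part of the
surrounding graph. -/
theorem reducible_cons_of_crossPath_pos {A : ℤ[X] × ℤ[X]} {t s : RForest} (ht : ¬ t.IsPath)
    (hA2 : CoeffPos A.2) (hA1 : CoeffNonneg A.1)
    (hA : ∀ k ≤ t.height, CoeffPos (crossPath (glue A s.pair) k)) : Reducible A (cons t s) := by
  obtain ⟨s', h1, h2, h3⟩ := exists_pairVal_lt_of_crossPath_pos ht (hA2.mul s.pair_snd_pos)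
    ((hA1.mul s.pair_snd_pos.1).add (hA2.1.mul s.pair_fst_nonneg)) hA
  refine ⟨s'.append s, ?_, ?_, ?_⟩
  · rw [size_append, h1]; simp only [size]
  · rw [leaves_append, h2]; simp only [leaves]
  · rw [pair, pair_append, glue_comm s'.pair, glue_comm (hang t.pair)]
    simpa only [glue_assoc] using h3

/-- This is the second move. A single vertex `t` is excluded because sliding onto it would lose a
leaf. -/
theorem reducible_cons_path {A : ℤ[X] × ℤ[X]} {t s : RForest} {k : ℕ} (hA2 : CoeffPos A.2)
    (hA1 : CoeffPos A.1) (ht : t ≠ nil) (h : CoeffPos (crossPath t.pair (k + 1))) :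
    Reducible A (cons (path k) (cons t s)) := by
  have h3 := pairVal_lt_of_crossPath_pos (B := glue A s.pair)
    ((hA1.mul s.pair_snd_pos).add_nonneg (hA2.1.mul s.pair_fst_nonneg)) h
  refine ⟨(cons (path (k + 1)) t).append s, ?_, ?_, ?_⟩
  · simp only [size_append, size, path]; omega
  · have h1 := leaves_path k
    have h2 := leaves_path (k + 1)
    have h4 := leaves_pos ht
    simp only [leaves_append, leaves]; omega
  · rw [glue_assoc, glue_comm s.pair, glue_assoc, glue_comm s.pair] at h3
    simpa only [pair, pair_append, glue_unit, glue_assoc] using h3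

/-- While the root has one child, that edge can be counted with `A`, which produces the stem. At the
first branching, either all branches are paths and only their lengths matter, or a non-path branch
admits one of the two moves. -/
theorem isBalanced_or_reducible {A : ℤ[X] × ℤ[X]} (f : RForest) (hA2 : CoeffPos A.2)
    (hA1 : CoeffPos A.1) : f.IsBalanced ∨ Reducible A f := by
  induction f generalizing A with
  | nil => exact Or.inl ⟨0, [], rfl, by simp⟩
  | cons c s hc _ =>
    by_cases hs : s = nil
    · subst hs
      have hv := _root_.pairVal_pos hA2 hA1.1
      rcases hc (A := hang A) (hv.add hA2) hv with ⟨q, L, rfl, h⟩ | ⟨c', h1, h2, h3⟩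
      · exact Or.inl ⟨q + 1, L, rfl, h⟩
      · refine Or.inr ⟨cons c' nil, ?_, ?_, ?_⟩
        · simp only [size, h1]
        · simp only [leaves, h2]
        · rwa [pair, pair, pair, pair, glue_unit, glue_unit, pairVal_glue_hang, pairVal_glue_hang]
    have hlen : 2 ≤ (cons c s).trees.length := by
      cases s with
      | nil => exact absurd rfl hs
      | cons c' s' => simp [trees]
    generalize cons c s = f at *
    by_cases hall : ∀ t ∈ f.trees, IsPath t
    · obtain ⟨L, hL⟩ : ∃ L : List ℕ, f.trees = L.map path := by
        choose! k hk using hall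
        exact ⟨f.trees.map k, by
          rw [List.map_map]
          exact (List.map_id _).symm.trans (List.map_congr_left hk)⟩
      by_cases hbal : ∀ a ∈ L, ∀ b ∈ L, a ≤ b + 1
      · exact Or.inl ⟨0, L, by rw [stretch, paths, ← hL, ofTrees_trees], hbal⟩
      · right
        push Not at hbal
        obtain ⟨a, ha, b, hb, hab⟩ := hbal
        obtain ⟨l1, h1⟩ : ∃ l1, L.Perm (b :: l1) := exists_perm_cons_of_mem hb
        have ha' : a ∈ l1 := by
          rcases List.mem_cons.1 (h1.subset ha) with h | h
          · omega
          · exact h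
        obtain ⟨l2, h2⟩ : ∃ l2, l1.Perm (a :: l2) := exists_perm_cons_of_mem ha'
        have h3 : f.trees.Perm (path b :: path a :: l2.map path) := by
          rw [hL]
          exact ((h1.trans (h2.cons b)).map path)
        refine Reducible.of_similar (exists_similar_cons_of_perm h3) ?_
        -- Two legs whose lengths differ by at least two: the second move lengthens the shorter one
        -- and shortens the longer one.
        rw [ofTrees]
        refine reducible_cons_path hA2 hA1 ?_ (crossPath_pair_path_pos hab)
        obtain ⟨a, rfl⟩ := Nat.exists_eq_succ_of_ne_zero (by omega : a ≠ 0)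
        simp [path]
    · right
      push Not at hall
      obtain ⟨t, ht, htP⟩ := hall
      obtain ⟨l1, h1⟩ : ∃ l1, f.trees.Perm (t :: l1) := exists_perm_cons_of_mem ht
      obtain ⟨t', l2, rfl⟩ : ∃ t' l2, l1 = t' :: l2 := by
        cases l1 with
        | nil => have := h1.length_eq; simp at this; omega
        | cons a b => exact ⟨a, b, rfl⟩
      -- A sibling `t'` at least as high as `t` makes the rest dominate the paths needed for the
      -- first move. Strictness comes from the positive first component of `A`.
      have key : ∀ (t t' : RForest) (l : List RForest), ¬ t.IsPath → t.height ≤ t'.height →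
          f.trees.Perm (t :: t' :: l) → Reducible A f := by
        intro t t' l ht hh hp
        refine Reducible.of_similar (exists_similar_cons_of_perm hp) ?_
        refine reducible_cons_of_crossPath_pos ht hA2 hA1.1 fun k hk => ?_
        rw [ofTrees, pair, glue_left_comm, crossPath_glue]
        have hv := t'.pairVal_pos
        have hB : CoeffPos (glue A (ofTrees l).pair).1 :=
          (hA1.mul (pair_snd_pos _)).add_nonneg (hA2.1.mul (pair_fst_nonneg _))
        refine CoeffNonneg.add_pos ((hA2.mul (pair_snd_pos _)).1.mul ?_)
          (((hv.add (pair_snd_pos _)).mul hB).mul (pair_snd_pos _))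
        cases k with
        | zero => rw [crossPath_zero]; exact hv.1
        | succ k => rw [crossPath_hang_succ]; exact crossPath_pair_nonneg _ (by omega)
      rcases le_total t.height t'.height with hh | hh
      · exact key t t' l2 htP hh h1
      · by_cases htP' : t'.IsPath
        · rcases hh.eq_or_lt with hh | hh
          · exact key t t' l2 htP hh.symm.le h1
          -- The remaining case is a path strictly lower than `t`, where the second move applies.
          obtain ⟨k, rfl⟩ := htP'
          rw [height_path] at hh
          refine Reducible.of_similar
            (exists_similar_cons_of_perm (h1.trans (List.Perm.swap _ _ _))) ?_
          exact reducible_cons_path hA2 hA1 (fun h => htP (h ▸ isPath_nil))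
            (crossPath_pair_pos_of_not_isPath _ hh htP)
        · exact key t' t l2 htP' hh (h1.trans (List.Perm.swap _ _ _))

end RForest

/-! ### Pairs of chains and cycles. -/

/-- The pair `(φ, h)` of a rooted graph represented by `(φ - x h, h)`. -/
noncomputable def fullPair (p : ℤ[X] × ℤ[X]) : ℤ[X] × ℤ[X] := (pairVal p, p.2)

/-- The pair of a path to whose vertices rooted graphs are attached, hanging from a new root.
The first vertex is the one at the far end, and `a` is its pair. -/
noncomputable def chainPair (a : ℤ[X] × ℤ[X]) : List (ℤ[X] × ℤ[X]) → ℤ[X] × ℤ[X]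
  | [] => hang a
  | b :: l => chainPair (glue b (hang a)) l

/-- The pair of a cycle to whose vertices other than the root rooted graphs are attached. -/
noncomputable def cyclePair : List (ℤ[X] × ℤ[X]) → ℤ[X] × ℤ[X]
  | [] => (0, 1)
  | a :: l => chainPair a l + glue (fullPair a) (cyclePair l)

/-- The pair has nonnegative coefficients, and its second component is nonzero. -/
structure GoodPair (p : ℤ[X] × ℤ[X]) : Prop where
  snd_pos : CoeffPos p.2
  fst_nonneg : CoeffNonneg p.1

/-- The rooted graph is larger than all paths with at most `K` edges. -/
def Dominates (p : ℤ[X] × ℤ[X]) (K : ℕ) : Prop := ∀ k ≤ K, CoeffPos (crossPath p k)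

theorem RForest.goodPair (f : RForest) : GoodPair f.pair := ⟨f.pair_snd_pos, f.pair_fst_nonneg⟩

theorem GoodPair.pairVal_pos {p : ℤ[X] × ℤ[X]} (h : GoodPair p) : CoeffPos (pairVal p) :=
  _root_.pairVal_pos h.1 h.2

theorem GoodPair.glue {p q : ℤ[X] × ℤ[X]} (hp : GoodPair p) (hq : GoodPair q) :
    GoodPair (glue p q) :=
  ⟨hp.1.mul hq.1, (hp.2.mul hq.1.1).add (hp.1.1.mul hq.2)⟩

theorem GoodPair.hang {p : ℤ[X] × ℤ[X]} (hp : GoodPair p) : GoodPair (hang p) :=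
  ⟨hp.pairVal_pos.add hp.1, hp.pairVal_pos.1⟩

theorem GoodPair.fullPair {p : ℤ[X] × ℤ[X]} (hp : GoodPair p) : GoodPair (fullPair p) :=
  ⟨hp.1, hp.pairVal_pos.1⟩

theorem Dominates.glue {p q : ℤ[X] × ℤ[X]} {K : ℕ} (h : Dominates p K) (hp : GoodPair p)
    (hq : GoodPair q) : Dominates (glue p q) K := fun k hk => by
  rw [crossPath_glue]
  exact (hq.1.mul (h k hk)).add_nonneg ((hp.1.1.mul hq.2).mul (RForest.pair_snd_pos _).1)

theorem Dominates.hang {p : ℤ[X] × ℤ[X]} {K : ℕ} (h : Dominates p K) (hp : GoodPair p) :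
    Dominates (hang p) K := fun k hk => by
  cases k with
  | zero => rw [crossPath_zero]; exact hp.pairVal_pos
  | succ k => rw [crossPath_hang_succ]; exact h k (by omega)

theorem Dominates.fullPair {p : ℤ[X] × ℤ[X]} {K : ℕ} (h : Dominates p K) (hp : GoodPair p) :
    Dominates (fullPair p) K := fun k hk => by
  have : crossPath (_root_.fullPair p) k =
      crossPath p k + X * p.2 * (RForest.path k).pair.2 := by
    simp only [crossPath, _root_.fullPair, pairVal]; ring
  rw [this]
  exact (h k hk).add ((CoeffPos.X.mul hp.1).mul (RForest.pair_snd_pos _))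

theorem crossPath_add (p q : ℤ[X] × ℤ[X]) (k : ℕ) :
    crossPath (p + q) k = crossPath p k + crossPath q k := by
  simp only [crossPath, Prod.fst_add, Prod.snd_add]; ring

theorem goodPair_chainPair {a : ℤ[X] × ℤ[X]} {l : List (ℤ[X] × ℤ[X])} (ha : GoodPair a)
    (hl : ∀ b ∈ l, GoodPair b) : GoodPair (chainPair a l) ∧ CoeffPos (chainPair a l).1 := by
  induction l generalizing a with
  | nil => exact ⟨ha.hang, ha.pairVal_pos⟩
  | cons b l ih =>
    exact ih ((hl b (by simp)).glue ha.hang) fun c hc => hl c (by simp [hc])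

/-- One dominating graph anywhere on the chain suffices, as both gluing and hanging preserve
domination. -/
theorem dominates_chainPair {a : ℤ[X] × ℤ[X]} {l : List (ℤ[X] × ℤ[X])} {K : ℕ}
    (ha : GoodPair a) (hl : ∀ b ∈ l, GoodPair b) (h : ∃ b ∈ a :: l, Dominates b K) :
    Dominates (chainPair a l) K := by
  induction l generalizing a with
  | nil =>
    obtain ⟨b, hb, hK⟩ := h
    obtain rfl : b = a := by simpa using hb
    exact hK.hang ha
  | cons b l ih =>
    have hb := hl b (by simp)
    refine ih (hb.glue ha.hang) (fun c hc => hl c (by simp [hc])) ?_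
    obtain ⟨c, hc, hK⟩ := h
    simp only [List.mem_cons] at hc
    rcases hc with rfl | rfl | hc
    · exact ⟨_, by simp, glue_comm (hang c) b ▸ (hK.hang ha).glue ha.hang hb⟩
    · exact ⟨_, by simp, hK.glue hb ha.hang⟩
    · exact ⟨c, by simp [hc], hK⟩

theorem goodPair_cyclePair {l : List (ℤ[X] × ℤ[X])} (hl : ∀ b ∈ l, GoodPair b) :
    GoodPair (cyclePair l) := by
  induction l with
  | nil => exact ⟨CoeffPos.one, CoeffNonneg.zero⟩
  | cons a l ih =>
    have ha := hl a (by simp)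
    have hl' : ∀ b ∈ l, GoodPair b := fun b hb => hl b (by simp [hb])
    have h1 := (goodPair_chainPair ha hl').1
    have h2 := ha.fullPair.glue (ih hl')
    exact ⟨h1.1.add h2.1, h1.2.add h2.2⟩

theorem cyclePair_fst_pos {l : List (ℤ[X] × ℤ[X])} (hl : ∀ b ∈ l, GoodPair b) (h : l ≠ []) :
    CoeffPos (cyclePair l).1 := by
  cases l with
  | nil => exact absurd rfl h
  | cons a l =>
    have ha := hl a (by simp)
    have hl' : ∀ b ∈ l, GoodPair b := fun b hb => hl b (by simp [hb])
    exact (goodPair_chainPair ha hl').2.add_nonneg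
      (ha.fullPair.glue (goodPair_cyclePair hl')).2

theorem dominates_cyclePair {l : List (ℤ[X] × ℤ[X])} {K : ℕ} (hl : ∀ b ∈ l, GoodPair b)
    (h : ∃ b ∈ l, Dominates b K) : Dominates (cyclePair l) K := by
  induction l with
  | nil => simp at h
  | cons a l ih =>
    have ha := hl a (by simp)
    have hl' : ∀ b ∈ l, GoodPair b := fun b hb => hl b (by simp [hb])
    intro k hk
    rw [cyclePair, crossPath_add]
    refine (dominates_chainPair ha hl' h k hk).add ?_
    obtain ⟨b, hb, hK⟩ := h
    rcases List.mem_cons.1 hb with rfl | hb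
    · exact (hK.fullPair ha).glue ha.fullPair (goodPair_cyclePair hl') k hk
    · rw [glue_comm]
      exact (ih hl' ⟨b, hb, hK⟩).glue (goodPair_cyclePair hl') ha.fullPair k hk

/-- The values of `p` at the indices other than `i`, in cyclic order starting after `i`. -/
def cyclicOthers {α : Type*} {n : ℕ} (p : Fin (n + 1) → α) (i : Fin (n + 1)) : List α :=
  List.ofFn fun k : Fin n => p (k.castSucc + (i + 1))

/-- In the rotation that starts at `i + 1`, the index `i` comes last; hence `cyclicOthers` omits
exactly it. -/
theorem last_add_add_one {n : ℕ} (i : Fin (n + 1)) : Fin.last n + (i + 1) = i := by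
  rw [add_comm i, ← add_assoc, Fin.last_add_one, zero_add]

theorem mem_cyclicOthers {α : Type*} {n : ℕ} (p : Fin (n + 1) → α) {i j : Fin (n + 1)}
    (h : j ≠ i) : p j ∈ cyclicOthers p i := by
  rw [cyclicOthers, List.mem_ofFn]
  obtain ⟨k, hk⟩ | hk := Fin.eq_castSucc_or_eq_last (j - (i + 1))
  · exact ⟨k, by rw [← hk, sub_add_cancel]⟩
  · exact absurd (by rw [← last_add_add_one i, ← hk, sub_add_cancel]) h

theorem castSucc_add_add_one_ne {n : ℕ} (k : Fin n) (i : Fin (n + 1)) :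
    k.castSucc + (i + 1) ≠ i := by
  intro h
  exact (Fin.castSucc_lt_last k).ne (add_right_cancel (h.trans (last_add_add_one i).symm))

theorem cyclicOthers_update {α : Type*} {n : ℕ} (p : Fin (n + 1) → α) (i : Fin (n + 1)) (a : α) :
    cyclicOthers (Function.update p i a) i = cyclicOthers p i := by
  unfold cyclicOthers
  congr 1
  funext k
  exact Function.update_of_ne (castSucc_add_add_one_ne k i) _ _

theorem goodPair_of_mem_cyclicOthers {n : ℕ} (f : Fin (n + 1) → RForest) (i : Fin (n + 1)) :
    ∀ b ∈ cyclicOthers (fun i => (f i).pair) i, GoodPair b := by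
  intro b hb
  rw [cyclicOthers, List.mem_ofFn] at hb
  obtain ⟨k, rfl⟩ := hb
  exact RForest.goodPair _

/-! ### Reduction of a whole family on the cycle. -/

namespace RForest

/-- The root has exactly one child, and its subtree is not a path. -/
def HasStem (f : RForest) : Prop := ∃ t, f = cons t nil ∧ ¬ t.IsPath

/-- Every family of rooted trees attached to a cycle can be replaced by a family of balanced
trees, at most one of which has a stem; this makes the characteristic polynomial smaller unless
the family is of this form. -/
theorem exists_balanced_family {n : ℕ} (hn : 1 ≤ n) (Φ : (Fin (n + 1) → RForest) → ℤ[X])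
    (hΦ : ∀ f i, Φ f =
      pairVal (glue (cyclePair (cyclicOthers (fun i => (f i).pair) i)) (f i).pair))
    (f : Fin (n + 1) → RForest) :
    ∃ f' : Fin (n + 1) → RForest, (∀ i, (f' i).size = (f i).size) ∧
      (∀ i, (f' i).leaves = (f i).leaves) ∧ (∀ i, (f' i).IsBalanced) ∧
      (∀ i j, i ≠ j → (f' i).HasStem → ¬ (f' j).HasStem) ∧
      (f' = f ∨ CoeffPos (Φ f - Φ f')) := by
  have hpos : ∀ f, CoeffPos (Φ f) := fun f => by
    rw [hΦ f 0]
    exact ((goodPair_cyclePair (goodPair_of_mem_cyclicOthers f 0)).glue (goodPair _)).pairVal_pos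
  -- The value at `1` is positive and drops with every reduction.
  induction hN : ((Φ f).eval 1).toNat using Nat.strong_induction_on generalizing f with
  | _ N ih =>
    have step : ∀ i, Reducible (cyclePair (cyclicOthers (fun i => (f i).pair) i)) (f i) →
        ∃ f' : Fin (n + 1) → RForest, (∀ i, (f' i).size = (f i).size) ∧
          (∀ i, (f' i).leaves = (f i).leaves) ∧ (∀ i, (f' i).IsBalanced) ∧
          (∀ i j, i ≠ j → (f' i).HasStem → ¬ (f' j).HasStem) ∧
          (f' = f ∨ CoeffPos (Φ f - Φ f')) := by
      rintro i ⟨t, h1, h2, h3⟩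
      set f1 := Function.update f i t with hf1
      have hlt : CoeffPos (Φ f - Φ f1) := by
        have : (fun j => (f1 j).pair) = Function.update (fun j => (f j).pair) i t.pair := by
          funext j
          by_cases hj : j = i
          · subst hj; simp [hf1]
          · simp [hf1, hj]
        rw [hΦ f i, hΦ f1 i, this, cyclicOthers_update, hf1, Function.update_self]
        exact h3
      have h4 := hlt.eval_one
      have h5 := (hpos f).eval_one
      have h6 := (hpos f1).eval_one
      rw [eval_sub] at h4
      obtain ⟨f', g1, g2, g3, g4, g5⟩ := ih _ (by omega) f1 rfl
      refine ⟨f', fun j => (g1 j).trans ?_, fun j => (g2 j).trans ?_, g3, g4, Or.inr ?_⟩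
      · by_cases hj : j = i
        · subst hj; simp [hf1, h1]
        · simp [hf1, hj]
      · by_cases hj : j = i
        · subst hj; simp [hf1, h2]
        · simp [hf1, hj]
      · rcases g5 with rfl | g5
        · exact hlt
        · have := hlt.add g5
          rwa [sub_add_sub_cancel] at this
    have hgood := fun i => goodPair_cyclePair (goodPair_of_mem_cyclicOthers f i)
    have hfst : ∀ i, CoeffPos (cyclePair (cyclicOthers (fun i => (f i).pair) i)).1 := fun i =>
      cyclePair_fst_pos (goodPair_of_mem_cyclicOthers f i) (by
        intro h
        have := congrArg List.length h
        simp [cyclicOthers] at this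
        omega)
    by_cases hbal : ∀ i, (f i).IsBalanced
    · by_cases hstem : ∀ i j, i ≠ j → (f i).HasStem → ¬ (f j).HasStem
      · exact ⟨f, fun _ => rfl, fun _ => rfl, hbal, hstem, Or.inl rfl⟩
      · push Not at hstem
        obtain ⟨i, j, hij, hi, hj⟩ := hstem
        -- The tree of smaller height is modified; the other one then lies on the cycle as seen from
        -- `i` and dominates all paths up to its own height.
        wlog hle : (f i).height ≤ (f j).height generalizing i j
        · exact this j i hij.symm hj hi (le_of_not_ge hle)
        obtain ⟨t, ht, htP⟩ := hi
        obtain ⟨t', ht', htP'⟩ := hj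
        refine step i ?_
        have hfj : ¬ (f j).IsPath := by
          rintro ⟨k, hk⟩
          rw [ht'] at hk
          cases k with
          | zero => simp [path] at hk
          | succ k =>
            rw [path, cons.injEq] at hk
            exact htP' ⟨k, hk.1⟩
        have hdom := dominates_cyclePair (goodPair_of_mem_cyclicOthers f i)
          ⟨_, mem_cyclicOthers (fun i => (f i).pair) hij.symm,
            fun k hk => crossPath_pair_pos_of_not_isPath (f j) hk hfj⟩
        have hA := hgood i
        generalize cyclePair (cyclicOthers (fun i => (f i).pair) i) = A at hdom hA ⊢
        rw [ht]
        -- The stem makes the root of tree `i` the parent of a non-path branch, so its branches can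
        -- move up towards the cycle.
        refine reducible_cons_of_crossPath_pos htP hA.1 hA.2 fun k hk => ?_
        rw [pair, glue_unit]
        refine hdom k (le_trans ?_ hle)
        rw [ht]
        simp only [height]
        omega
    · push Not at hbal
      obtain ⟨i, hi⟩ := hbal
      exact step i ((isBalanced_or_reducible (f i) (hgood i).1 (hfst i)).resolve_left hi)

end RForest

/-! ### Deletion and contraction for weighted Laplacians. -/

section Contraction

variable {R : Type*} [CommRing R]

/-- The vector `e_i - e_j` of an edge joining `i` and `j`. -/
def edgeVec {m : ℕ} (i j : Fin m) : Fin m → R := Pi.single i 1 - Pi.single j 1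

/-- The image of a vector when the index `0` is merged into the index `a + 1`. -/
def mergeVec {n : ℕ} (a : Fin (n + 1)) (w : Fin (n + 2) → R) : Fin (n + 1) → R :=
  fun k => w k.succ + if k = a then w 0 else 0

/-- The image of a bilinear form when the index `0` is merged into the index `a + 1`. -/
def mergeMatrix {n : ℕ} (a : Fin (n + 1)) (Z : Matrix (Fin (n + 2)) (Fin (n + 2)) R) :
    Matrix (Fin (n + 1)) (Fin (n + 1)) R :=
  Matrix.of fun i => mergeVec a fun l => mergeVec a (fun k => Z k l) i

theorem mergeMatrix_add {n : ℕ} (a : Fin (n + 1)) (Y Z : Matrix (Fin (n + 2)) (Fin (n + 2)) R) :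
    mergeMatrix a (Y + Z) = mergeMatrix a Y + mergeMatrix a Z := by
  ext i j
  simp only [mergeMatrix, mergeVec, Matrix.of_apply, Matrix.add_apply]
  split_ifs <;> ring

theorem mergeMatrix_sum {n : ℕ} (a : Fin (n + 1)) {ι : Type*} (s : Finset ι)
    (Z : ι → Matrix (Fin (n + 2)) (Fin (n + 2)) R) :
    mergeMatrix a (∑ k ∈ s, Z k) = ∑ k ∈ s, mergeMatrix a (Z k) :=
  map_sum (AddMonoidHom.mk' (mergeMatrix a) (mergeMatrix_add a)) Z s

theorem mergeMatrix_vecMulVec {n : ℕ} (a : Fin (n + 1)) (v w : Fin (n + 2) → R) :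
    mergeMatrix a (Matrix.vecMulVec v w) = Matrix.vecMulVec (mergeVec a v) (mergeVec a w) := by
  ext i j
  simp only [mergeMatrix, mergeVec, Matrix.of_apply, Matrix.vecMulVec_apply]
  split_ifs <;> ring

theorem mergeMatrix_diagonal {n : ℕ} (a : Fin (n + 1)) (w : Fin (n + 2) → R) :
    mergeMatrix a (Matrix.diagonal w) = Matrix.diagonal (mergeVec a w) := by
  ext i j
  simp only [mergeMatrix, mergeVec, Matrix.of_apply, Matrix.diagonal_apply, Fin.succ_inj,
    Fin.succ_ne_zero, (Fin.succ_ne_zero _).symm, if_true, if_false]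
  split_ifs <;> simp_all

/-- Merging two indices is a unimodular change of basis followed by deleting the row and column `0`.
-/
theorem mergeMatrix_eq_submatrix {n : ℕ} (a : Fin (n + 1))
    (Z : Matrix (Fin (n + 2)) (Fin (n + 2)) R) :
    mergeMatrix a Z = ((Matrix.transvection 0 a.succ (1 : R)).transpose * Z *
      Matrix.transvection 0 a.succ 1).submatrix Fin.succ Fin.succ := by
  have h : ∀ (M : Matrix (Fin (n + 2)) (Fin (n + 2)) R) (i j : Fin (n + 2)),
      (M * Matrix.transvection 0 a.succ (1 : R)) i j = M i j + if j = a.succ then M i 0 else 0 := by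
    intro M i j
    split_ifs with hj
    · subst hj; simp
    · rw [Matrix.mul_transvection_apply_of_ne _ _ _ _ hj, add_zero]
  have h' : ∀ (M : Matrix (Fin (n + 2)) (Fin (n + 2)) R) (i j : Fin (n + 2)),
      ((Matrix.transvection 0 a.succ (1 : R)).transpose * M) i j =
        M i j + if i = a.succ then M 0 j else 0 := by
    intro M i j
    rw [← Matrix.transpose_transpose M, ← Matrix.transpose_mul, Matrix.transpose_apply, h]
    rfl
  ext i j
  simp only [mergeMatrix, mergeVec, Matrix.of_apply, Matrix.submatrix_apply, h, h', Fin.succ_inj]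

theorem det_add_single_zero_zero {n : ℕ} (M : Matrix (Fin (n + 1)) (Fin (n + 1)) R) :
    (M + Matrix.single 0 0 1).det = M.det + (M.submatrix Fin.succ Fin.succ).det := by
  rw [Matrix.det_succ_row_zero, Matrix.det_succ_row_zero M, Fin.sum_univ_succ, Fin.sum_univ_succ]
  have h : ∀ j : Fin (n + 1), (M + Matrix.single 0 0 1).submatrix Fin.succ j.succAbove =
      M.submatrix Fin.succ j.succAbove := by
    intro j
    ext i k
    simp [(Fin.succ_ne_zero _).symm]
  simp only [h]
  simp [(Fin.succ_ne_zero _).symm]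
  ring

/-- Deletion and contraction of an edge. -/
theorem det_add_edge {n : ℕ} (a : Fin (n + 1)) (Z : Matrix (Fin (n + 2)) (Fin (n + 2)) R) :
    (Z + Matrix.vecMulVec (edgeVec 0 a.succ) (edgeVec 0 a.succ)).det =
      Z.det + (mergeMatrix a Z).det := by
  set U := Matrix.transvection 0 a.succ (1 : R) with hU
  have hdet : U.det = 1 := Matrix.det_transvection_of_ne _ _ (Fin.succ_ne_zero a).symm 1
  have hconj : ∀ M, (U.transpose * M * U).det = M.det := by
    intro M
    rw [Matrix.det_mul, Matrix.det_mul, Matrix.det_transpose, hdet, one_mul, mul_one]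
  rw [← hconj, ← hconj Z, mergeMatrix_eq_submatrix, ← hU, ← det_add_single_zero_zero]
  congr 1
  rw [Matrix.mul_add, Matrix.add_mul, Matrix.mul_vecMulVec, Matrix.vecMulVec_mul]
  -- In the new basis the edge vector is `e_0`, so the edge only adds `1` to the corner entry.
  have hv : Matrix.vecMul (edgeVec 0 a.succ) U = Pi.single 0 1 := by
    rw [hU, Matrix.transvection, Matrix.vecMul_add, Matrix.vecMul_one]
    ext k
    by_cases hk : k = a.succ
    · subst hk
      simp [edgeVec, Matrix.vecMul, dotProduct, Matrix.single_apply, Pi.single_apply,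
        (Fin.succ_ne_zero _).symm]
    · simp [edgeVec, Matrix.vecMul, dotProduct, hk, Ne.symm hk]
  rw [Matrix.mulVec_transpose, hv]
  congr 1
  ext i j
  by_cases hi : i = 0 <;> by_cases hj : j = 0 <;>
    simp [Matrix.vecMulVec_apply, hi, hj, eq_comm]

/-- The Laplacian matrix of the path `0, 1, …, n`, plus a diagonal matrix. -/
def pathMatrix (n : ℕ) (ψ : Fin (n + 1) → R) : Matrix (Fin (n + 1)) (Fin (n + 1)) R :=
  Matrix.diagonal ψ +
    ∑ k : Fin n, Matrix.vecMulVec (edgeVec k.castSucc k.succ) (edgeVec k.castSucc k.succ)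

/-- The Laplacian matrix of the cycle `0, 1, …, n`, plus a diagonal matrix. -/
def cycleMatrix (n : ℕ) (ψ : Fin (n + 1) → R) : Matrix (Fin (n + 1)) (Fin (n + 1)) R :=
  pathMatrix n ψ + Matrix.vecMulVec (edgeVec 0 (Fin.last n)) (edgeVec 0 (Fin.last n))

theorem mergeVec_edgeVec_succ {n : ℕ} (a i j : Fin (n + 1)) :
    mergeVec a (edgeVec i.succ j.succ) = (edgeVec i j : Fin (n + 1) → R) := by
  ext k
  simp [mergeVec, edgeVec, Pi.single_apply, (Fin.succ_ne_zero _).symm]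

theorem mergeVec_edgeVec_zero {n : ℕ} (a j : Fin (n + 1)) :
    mergeVec a (edgeVec 0 j.succ) = (edgeVec a j : Fin (n + 1) → R) := by
  ext k
  simp [mergeVec, edgeVec, Pi.single_apply, (Fin.succ_ne_zero _).symm]
  ring

theorem edgeVec_swap {m : ℕ} (i j : Fin m) :
    Matrix.vecMulVec (edgeVec i j) (edgeVec i j) =
      (Matrix.vecMulVec (edgeVec j i) (edgeVec j i) : Matrix (Fin m) (Fin m) R) := by
  ext k l
  simp only [Matrix.vecMulVec_apply, edgeVec, Pi.sub_apply]
  ring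

theorem det_pathMatrix_zero (ψ : Fin 1 → R) : (pathMatrix 0 ψ).det = ψ 0 := by
  simp [pathMatrix]

/-- Deleting the first edge splits off the vertex `0` with factor `ψ 0`; contracting it adds `ψ 0`
to the weight of the next vertex. -/
theorem det_pathMatrix_succ (n : ℕ) (ψ : Fin (n + 2) → R) :
    (pathMatrix (n + 1) ψ).det =
      ψ 0 * (pathMatrix n (Fin.tail ψ)).det + (pathMatrix n (mergeVec 0 ψ)).det := by
  set Z : Matrix (Fin (n + 2)) (Fin (n + 2)) R := Matrix.diagonal ψ +
    ∑ k : Fin n, Matrix.vecMulVec (edgeVec k.castSucc.succ k.succ.succ)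
      (edgeVec k.castSucc.succ k.succ.succ) with hZ
  have h1 : pathMatrix (n + 1) ψ =
      Z + Matrix.vecMulVec (edgeVec 0 (0 : Fin (n + 1)).succ) (edgeVec 0 (0 : Fin (n + 1)).succ) := by
    rw [pathMatrix, Fin.sum_univ_succ, hZ, add_assoc (Matrix.diagonal ψ)]
    congr 1
    exact add_comm _ _
  have h2 : mergeMatrix 0 Z = pathMatrix n (mergeVec 0 ψ) := by
    rw [hZ, mergeMatrix_add, mergeMatrix_sum, mergeMatrix_diagonal, pathMatrix]
    simp only [mergeMatrix_vecMulVec, mergeVec_edgeVec_succ]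
  have hsub : Z.submatrix Fin.succ Fin.succ = pathMatrix n (Fin.tail ψ) := by
    ext i j
    simp only [hZ, pathMatrix, Matrix.submatrix_apply, Matrix.add_apply, Matrix.sum_apply,
      Matrix.vecMulVec_apply, Matrix.diagonal_apply, Fin.succ_inj, edgeVec, Pi.sub_apply,
      Pi.single_apply]
    rfl
  have h3 : Z.det = ψ 0 * (pathMatrix n (Fin.tail ψ)).det := by
    rw [Matrix.det_succ_row_zero, Fin.sum_univ_succ, Finset.sum_eq_zero, add_zero]
    · rw [← hsub, hZ]
      simp [Matrix.sum_apply, Matrix.vecMulVec_apply, edgeVec, (Fin.succ_ne_zero _).symm]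
    · intro j _
      simp [hZ, Matrix.sum_apply, Matrix.vecMulVec_apply, edgeVec, Pi.single_apply,
        (Fin.succ_ne_zero _).symm]
  rw [h1, det_add_edge, h2, h3]

/-- The closing edge is here a loop, whose edge vector vanishes. -/
theorem det_cycleMatrix_zero (ψ : Fin 1 → R) : (cycleMatrix 0 ψ).det = ψ 0 := by
  simp [cycleMatrix, pathMatrix, edgeVec]

/-- Deleting the closing edge leaves a path. Contracting it turns the edge from `0` to `1` into the
closing edge of a shorter cycle. -/
theorem det_cycleMatrix_succ (n : ℕ) (ψ : Fin (n + 2) → R) :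
    (cycleMatrix (n + 1) ψ).det =
      (pathMatrix (n + 1) ψ).det + (cycleMatrix n (mergeVec (Fin.last n) ψ)).det := by
  rw [cycleMatrix, ← Fin.succ_last, det_add_edge]
  congr 2
  rw [pathMatrix, mergeMatrix_add, mergeMatrix_sum, mergeMatrix_diagonal, cycleMatrix, pathMatrix,
    Fin.sum_univ_succ, edgeVec_swap 0 (Fin.last n),
    add_assoc (Matrix.diagonal _)]
  congr 1
  refine (add_comm _ _).trans ?_
  simp only [mergeMatrix_vecMulVec, ← Fin.succ_castSucc, mergeVec_edgeVec_succ, Fin.castSucc_zero,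
    mergeVec_edgeVec_zero]

end Contraction

/-! ### Deletion and contraction in terms of pairs. -/

section Pairs

variable {R : Type*} [CommRing R]

/-- The determinant of the path with attached rooted graphs, by deletion and contraction. -/
def pathValue (a : R × R) : List (R × R) → R
  | [] => a.1
  | b :: l => a.1 * pathValue b l + pathValue (glue a b) l

/-- The analogue of `chainPair` for pairs `(φ, h)`. -/
def chainFull (a : R × R) : List (R × R) → R × R
  | [] => (a.1, a.1 + a.2)
  | b :: l => chainFull (glue b (a.1, a.1 + a.2)) l

/-- The analogue of `cyclePair` for pairs `(φ, h)`. -/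
def cycleFull : List (R × R) → R × R
  | [] => (0, 1)
  | a :: l => chainFull a l + glue a (cycleFull l)

theorem glue_add {p q r : R × R} : glue p (q + r) = glue p q + glue p r := by
  ext : 1 <;> simp only [glue, Prod.fst_add, Prod.snd_add] <;> ring

/-- Linearity in the far end allows the deleted and the contracted chain to be combined into one. -/
theorem chainFull_linear (c : R) (a b : R × R) (l : List (R × R)) :
    c • chainFull a l + chainFull b l = chainFull (c • a + b) l := by
  induction l generalizing a b with
  | nil =>
    ext : 1
    · simp [chainFull]
    · simp [chainFull]; ring
  | cons d l ih =>
    rw [chainFull, chainFull, ih, chainFull]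
    congr 1
    ext : 1 <;> simp [glue] <;> ring

/-- The deletion term `a.1 • b` and the contraction term `glue a b` add up to `b` with `a` hung from
it, which turns the branching recursion into a transfer along the chain. -/
theorem pathValue_append (a r : R × R) (l : List (R × R)) :
    pathValue a (l ++ [r]) = (glue r (chainFull a l)).1 := by
  induction l generalizing a with
  | nil => simp [pathValue, glue, chainFull]; ring
  | cons b l ih =>
    rw [List.cons_append, pathValue, ih, ih, chainFull]
    have := chainFull_linear a.1 b (glue a b) l
    have h : a.1 • b + glue a b = glue b (a.1, a.1 + a.2) := by
      ext : 1 <;> simp [glue] <;> ring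
    rw [← h, ← this, glue_add]
    simp [glue]
    ring

theorem chainFull_fullPair (a : ℤ[X] × ℤ[X]) (l : List (ℤ[X] × ℤ[X])) :
    chainFull (fullPair a) (l.map fullPair) = chainPair a l := by
  induction l generalizing a with
  | nil => rfl
  | cons b l ih =>
    rw [List.map_cons, chainFull, chainPair, ← ih]
    congr 1
    ext : 1
    · simp only [glue, fullPair, pairVal, hang]
      ring
    · simp only [glue, fullPair, pairVal, hang]

theorem cycleFull_fullPair (l : List (ℤ[X] × ℤ[X])) :
    cycleFull (l.map fullPair) = cyclePair l := by
  induction l with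
  | nil => rfl
  | cons b l ih => rw [List.map_cons, cycleFull, cyclePair, ih, chainFull_fullPair]

theorem map_glue {S : Type*} [CommRing S] (f : R →+* S) (p q : R × R) :
    Prod.map f f (glue p q) = glue (Prod.map f f p) (Prod.map f f q) := by
  ext : 1 <;> simp [glue]

theorem map_chainFull {S : Type*} [CommRing S] (f : R →+* S) (a : R × R) (l : List (R × R)) :
    Prod.map f f (chainFull a l) = chainFull (Prod.map f f a) (l.map (Prod.map f f)) := by
  induction l generalizing a with
  | nil => simp [chainFull]
  | cons b l ih => rw [chainFull, ih, List.map_cons, chainFull, map_glue]; congr 2; ext : 1 <;> simp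

theorem map_cycleFull {S : Type*} [CommRing S] (f : R →+* S) (l : List (R × R)) :
    Prod.map f f (cycleFull l) = cycleFull (l.map (Prod.map f f)) := by
  induction l with
  | nil => simp [cycleFull]
  | cons a l ih =>
    rw [cycleFull, List.map_cons, cycleFull, ← ih, ← map_chainFull, ← map_glue]
    ext : 1 <;> simp

end Pairs

/-! ### Weighted cycles with ratios of pairs as weights. -/

section Field

variable {K : Type*} [Field K]

/-- The weights are `φ / h`. Contraction adds weights, as `glue` does with ratios, and the product
of the `h` clears denominators. -/
theorem prod_mul_det_pathMatrix (n : ℕ) (p : Fin (n + 1) → K × K) (hp : ∀ i, (p i).2 ≠ 0) :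
    (∏ i, (p i).2) * (pathMatrix n fun i => (p i).1 / (p i).2).det =
      pathValue (p 0) (List.ofFn (Fin.tail p)) := by
  induction n with
  | zero =>
    rw [det_pathMatrix_zero]
    simp [pathValue, mul_div_cancel₀ _ (hp 0)]
  | succ n ih =>
    rw [det_pathMatrix_succ, List.ofFn_succ, pathValue]
    have h1 := ih (Fin.tail p) fun i => hp _
    have h2 := ih (Function.update (Fin.tail p) 0 (glue (p 0) (p 1))) (by
      intro i
      by_cases hi : i = 0
      · subst hi; simpa [glue] using ⟨hp 0, hp 1⟩
      · simpa [hi, Fin.tail] using hp _)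
    have h3 : (fun i => (Function.update (Fin.tail p) 0 (glue (p 0) (p 1)) i).1 /
        (Function.update (Fin.tail p) 0 (glue (p 0) (p 1)) i).2) =
        mergeVec 0 fun i => (p i).1 / (p i).2 := by
      funext i
      by_cases hi : i = 0
      · subst hi
        have h0 := hp 0
        have h1 := hp 1
        simp [mergeVec, glue]
        field_simp
        ring
      · simp [mergeVec, hi, Fin.tail]
    rw [h3] at h2
    have h4 : ∏ i, (Function.update (Fin.tail p) 0 (glue (p 0) (p 1)) i).2 = ∏ i, (p i).2 := by
      rw [Fin.prod_univ_succ, Fin.prod_univ_succ (fun i => (p i).2),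
        Fin.prod_univ_succ (fun i : Fin (n + 1) => (p i.succ).2)]
      simp [glue, Fin.tail, mul_assoc]
    rw [h4] at h2
    rw [mul_add, h2, Fin.prod_univ_succ]
    have h5 : Fin.tail (Function.update (Fin.tail p) 0 (glue (p 0) (p 1))) =
        fun i => Fin.tail p i.succ := by
      funext i
      simp [Fin.tail]
    have h6 : Fin.tail p 0 = p 1 := rfl
    rw [h5, Function.update_self, h6]
    rw [h6] at h1
    congr 1
    have h7 : Fin.tail (fun i => (p i).1 / (p i).2) =
      fun i => (Fin.tail p i).1 / (Fin.tail p i).2 := rfl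
    have h8 : (∏ i : Fin (n + 1), (p i.succ).2) = ∏ i, (Fin.tail p i).2 := rfl
    have h9 : Fin.tail (Fin.tail p) = fun i => Fin.tail p i.succ := rfl
    rw [← h9, ← h1, h7, h8]
    field_simp [hp 0]

theorem prod_mul_det_cycleMatrix (n : ℕ) (p : Fin (n + 1) → K × K) (hp : ∀ i, (p i).2 ≠ 0) :
    (∏ i, (p i).2) * (cycleMatrix n fun i => (p i).1 / (p i).2).det =
      (glue (p (Fin.last n)) (cycleFull (List.ofFn fun k : Fin n => p k.castSucc))).1 := by
  induction n with
  | zero =>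
    rw [det_cycleMatrix_zero]
    simp [glue, cycleFull, mul_div_cancel₀ _ (hp 0)]
  | succ n ih =>
    rw [det_cycleMatrix_succ, List.ofFn_succ, cycleFull, mul_add, prod_mul_det_pathMatrix _ _ hp]
    -- The contracted cycle carries the glued pair at its last vertex, which plays the part of the
    -- root.
    have h2 := ih (Function.update (Fin.tail p) (Fin.last n) (glue (p (Fin.last _)) (p 0))) (by
      intro i
      by_cases hi : i = Fin.last n
      · subst hi; simpa [glue] using ⟨hp _, hp 0⟩
      · simpa [hi, Fin.tail] using hp _)
    have h3 : (fun i => (Function.update (Fin.tail p) (Fin.last n)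
        (glue (p (Fin.last _)) (p 0)) i).1 /
        (Function.update (Fin.tail p) (Fin.last n) (glue (p (Fin.last _)) (p 0)) i).2) =
        mergeVec (Fin.last n) fun i => (p i).1 / (p i).2 := by
      funext i
      by_cases hi : i = Fin.last n
      · subst hi
        have h0 := hp 0
        have h1 := hp (Fin.last _)
        simp [mergeVec, glue]
        field_simp
      · simp [mergeVec, hi, Fin.tail]
    rw [h3] at h2
    have h4 : ∏ i, (Function.update (Fin.tail p) (Fin.last n)
        (glue (p (Fin.last _)) (p 0)) i).2 = ∏ i, (p i).2 := by
      rw [Fin.prod_univ_castSucc, Fin.prod_univ_succ (fun i => (p i).2),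
        Fin.prod_univ_castSucc (fun i : Fin (n + 1) => (p i.succ).2)]
      simp [glue, Fin.tail, (Fin.castSucc_lt_last _).ne]
      ring
    rw [h4] at h2
    rw [h2, Function.update_self]
    have h5 : (fun k : Fin n => Function.update (Fin.tail p) (Fin.last n)
        (glue (p (Fin.last _)) (p 0)) k.castSucc) = fun k => p k.succ.castSucc := by
      funext k
      simp [Fin.tail, (Fin.castSucc_lt_last _).ne]
    have h6 : List.ofFn (Fin.tail p) =
        (List.ofFn fun k : Fin n => p k.succ.castSucc) ++ [p (Fin.last _)] := by
      rw [List.ofFn_succ', List.concat_eq_append]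
      rfl
    rw [h5, h6, pathValue_append, glue_assoc, glue_add, Prod.fst_add]
    rfl

end Field

/-! ### The polynomial `det (x + L)` and the Laplacian coefficients. -/

section LaplacianPolynomial

variable {V W : Type*} [Fintype V] [Fintype W] {R : Type*} [CommRing R]

open Classical in
/-- The matrix `x I + L(G)`. -/
noncomputable def lapShift (G : SimpleGraph V) (x : R) : Matrix V V R :=
  Matrix.of fun u v => (if u = v then x + ∑ w, (if G.Adj u w then 1 else 0) else 0) -
    if G.Adj u v then 1 else 0

open Classical in
/-- The polynomial `det (x I + L(G))`. -/
noncomputable def lapPoly (G : SimpleGraph V) : ℤ[X] := (lapShift G X).det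

open Classical in
/-- The principal minor of `x I + L(G)` in which the vertex `r` is deleted. -/
noncomputable def rootMinor (G : SimpleGraph V) (r : V) : ℤ[X] := (lapShift G X).adjugate r r

theorem lapPoly_eq [DecidableEq V] (G : SimpleGraph V) : lapPoly G = (lapShift G X).det := by
  unfold lapPoly
  congr!

theorem rootMinor_eq [DecidableEq V] (G : SimpleGraph V) (r : V) :
    rootMinor G r = (lapShift G X).adjugate r r := by
  unfold rootMinor
  congr!

theorem lapShift_eq_lapMatrix [DecidableEq V] (G : SimpleGraph V) [DecidableRel G.Adj] (x : R) :
    lapShift G x = Matrix.diagonal (fun _ => x) + G.lapMatrix R := by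
  ext u v
  simp only [lapShift, SimpleGraph.lapMatrix, SimpleGraph.degMatrix, Matrix.of_apply,
    Matrix.add_apply, Matrix.sub_apply, Matrix.diagonal_apply, SimpleGraph.degree_eq_sum_if_adj,
    SimpleGraph.adjMatrix_apply, ← add_sub_assoc]
  by_cases h : u = v
  · simp only [h, if_true]
  · simp only [h, if_false, add_zero]
    congr!

open Classical in
theorem lapShift_iso {G : SimpleGraph V} {H : SimpleGraph W} (e : G ≃g H) (x : R) :
    (lapShift H x).submatrix e e = lapShift G x := by
  ext u v
  have h : (∑ w, if H.Adj (e u) w then (1 : R) else 0) = ∑ w, if G.Adj u w then 1 else 0 := by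
    rw [← Equiv.sum_comp e.toEquiv]
    exact Finset.sum_congr rfl fun w _ => if_congr e.map_adj_iff rfl rfl
  simp only [lapShift, Matrix.submatrix_apply, Matrix.of_apply, EmbeddingLike.apply_eq_iff_eq, h,
    SimpleGraph.Iso.map_adj_iff]

theorem lapPoly_iso {G : SimpleGraph V} {H : SimpleGraph W} (e : G ≃g H) :
    lapPoly G = lapPoly H := by
  classical
  rw [lapPoly_eq, lapPoly_eq, ← lapShift_iso e]
  exact Matrix.det_submatrix_equiv_self e.toEquiv _

/-- Substituting `-x` in the characteristic polynomial gives `(-1)^n det (x + L)`, and this cancels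
the sign `(-1)^k`. -/
theorem lapCoeff_eq (G : SimpleGraph V) {k : ℕ} (hk : k ≤ Fintype.card V) :
    lapCoeff G k = (lapPoly G).coeff (Fintype.card V - k) := by
  classical
  have h : (G.lapMatrix ℤ).charpoly.comp (-X) = (-1) ^ Fintype.card V * lapPoly G := by
    rw [lapPoly_eq, lapShift_eq_lapMatrix, ← Matrix.det_neg, Matrix.charpoly]
    change (Polynomial.compRingHom (-X)) _ = _
    rw [RingHom.map_det]
    congr 1
    ext1 u v
    by_cases huv : u = v
    · subst huv
      simp [SimpleGraph.lapMatrix, SimpleGraph.degMatrix]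
      ring
    · simp [SimpleGraph.lapMatrix, SimpleGraph.degMatrix, huv,
        SimpleGraph.adjMatrix_apply]
      split_ifs <;> simp
  have h' := congrArg (fun p => p.coeff (Fintype.card V - k)) h
  have h0 : (-X : ℤ[X]) = C (-1) * X := by simp
  rw [h0, comp_C_mul_X_coeff, mul_comm] at h'
  have h1 : ((-1 : ℤ[X]) ^ Fintype.card V) = C ((-1) ^ Fintype.card V) := by simp
  rw [h1, coeff_C_mul] at h'
  unfold lapCoeff
  have h2 : ((-1 : ℤ) ^ Fintype.card V) = (-1) ^ (Fintype.card V - k) * (-1) ^ k := by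
    rw [← pow_add, Nat.sub_add_cancel hk]
  rw [h2, mul_assoc] at h'
  have h3 : ((-1 : ℤ) ^ (Fintype.card V - k)) ≠ 0 := by simp
  have h4 : ((-1 : ℤ) ^ k) * (-1) ^ k = 1 := by rw [← mul_pow]; simp
  have h5 := mul_left_cancel₀ h3 h'
  calc _ = (-1 : ℤ) ^ k * ((-1) ^ k * (lapPoly G).coeff (Fintype.card V - k)) := by
        rw [← h5]
    _ = _ := by rw [← mul_assoc, h4, one_mul]

theorem natDegree_lapPoly_le (G : SimpleGraph V) : (lapPoly G).natDegree ≤ Fintype.card V := by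
  classical
  have h : lapShift G (X : ℤ[X]) =
      (X : ℤ[X]) • (1 : Matrix V V ℤ).map C + (G.lapMatrix ℤ).map C := by
    rw [lapShift_eq_lapMatrix]
    ext1 u v
    by_cases huv : u = v
    · subst huv
      simp [SimpleGraph.lapMatrix, SimpleGraph.degMatrix]
    · simp [SimpleGraph.lapMatrix, SimpleGraph.degMatrix, huv, SimpleGraph.adjMatrix_apply]
  rw [lapPoly_eq, h]
  exact Polynomial.natDegree_det_X_add_C_le _ _

end LaplacianPolynomial

/-! ### The Laplacian of the cycle graph. -/

section CycleMatrix

variable {R : Type*} [CommRing R]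

theorem lapShift_cycleGraph (n : ℕ) (ψ : Fin (n + 3) → R) :
    Matrix.diagonal ψ + lapShift (SimpleGraph.cycleGraph (n + 3)) 0 = cycleMatrix (n + 2) ψ := by
  have hsum : cycleMatrix (n + 2) ψ = Matrix.diagonal ψ +
      ∑ k : Fin (n + 3), Matrix.vecMulVec (edgeVec k (k + 1)) (edgeVec k (k + 1)) := by
    rw [Fin.sum_univ_castSucc, cycleMatrix, pathMatrix, edgeVec_swap 0, Fin.last_add_one]
    simp only [Fin.coeSucc_eq_succ]
    abel
  rw [hsum, lapShift_eq_lapMatrix]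
  congr 1
  have h1 : (1 : Fin (n + 3)) ≠ 0 := by simp
  -- With at least three vertices, `i - j` and `j - i` cannot both be `1`, so there is no double
  -- edge.
  have h2 : (1 : Fin (n + 3)) + 1 ≠ 0 := by
    rw [ne_eq, Fin.ext_iff, Fin.val_add]
    simp [Nat.mod_eq_of_lt (show 1 + 1 < n + 3 by omega)]
  ext i j
  have e1 : ∀ k, i = k + 1 ↔ k = i - 1 := fun k => by rw [eq_sub_iff_add_eq, eq_comm]
  have e2 : ∀ k, j = k + 1 ↔ k = j - 1 := fun k => by rw [eq_sub_iff_add_eq, eq_comm]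
  have hR : (∑ k : Fin (n + 3),
      Matrix.vecMulVec (edgeVec k (k + 1)) (edgeVec k (k + 1)) : Matrix _ _ R) i j =
      (if i = j then 2 else 0) - (if i - j = 1 then 1 else 0) - (if j - i = 1 then 1 else 0) := by
    simp only [Matrix.sum_apply, Matrix.vecMulVec_apply, edgeVec, Pi.sub_apply, Pi.single_apply,
      mul_sub, Finset.sum_sub_distrib, mul_ite, mul_one, mul_zero, e1, e2, Finset.sum_ite_eq',
      Finset.sum_ite_eq, Finset.mem_univ, if_true, sub_left_inj]
    have h3 : j = i - 1 ↔ i - j = 1 := by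
      rw [eq_sub_iff_add_eq, sub_eq_iff_eq_add', eq_comm]
    have h4 : i = j - 1 ↔ j - i = 1 := by
      rw [eq_sub_iff_add_eq, sub_eq_iff_eq_add', eq_comm]
    simp only [h3, h4]
    by_cases hij : i = j
    · subst hij; simp [h1.symm, one_add_one_eq_two]
    · simp [hij, Ne.symm hij]
  rw [hR]
  by_cases hij : i = j
  · subst hij
    simp [SimpleGraph.lapMatrix, SimpleGraph.degMatrix, SimpleGraph.cycleGraph_degree_three_le,
      h1.symm]
  · simp only [SimpleGraph.lapMatrix, SimpleGraph.degMatrix, Matrix.add_apply, Matrix.sub_apply,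
      Matrix.diagonal_apply, hij, if_false, zero_add, SimpleGraph.adjMatrix_apply,
      SimpleGraph.cycleGraph_adj, zero_sub]
    by_cases ha : i - j = 1 <;> by_cases hb : j - i = 1
    · rw [← neg_sub, ha] at hb
      exact absurd (by nth_rw 1 [← hb]; exact neg_add_cancel _) h2
    all_goals simp [ha, hb]

theorem lapShift_cycleGraph_add {n : ℕ} (c i j : Fin (n + 3)) (x : R) :
    lapShift (SimpleGraph.cycleGraph (n + 3)) x (i + c) (j + c) =
      lapShift (SimpleGraph.cycleGraph (n + 3)) x i j := by
  let e : SimpleGraph.cycleGraph (n + 3) ≃g SimpleGraph.cycleGraph (n + 3) :=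
    ⟨Equiv.addRight c, by simp [SimpleGraph.cycleGraph_adj]⟩
  exact congrFun (congrFun (lapShift_iso e x) i) j

/-- Rotational symmetry places any chosen vertex last, so any tree can serve as the one at the root.
-/
theorem prod_mul_det_cycleGraph {K : Type*} [Field K] (n : ℕ) (p : Fin (n + 3) → K × K)
    (hp : ∀ i, (p i).2 ≠ 0) (i : Fin (n + 3)) :
    (∏ i, (p i).2) * (Matrix.diagonal (fun i => (p i).1 / (p i).2) +
      lapShift (SimpleGraph.cycleGraph (n + 3)) 0).det =
      (glue (p i) (cycleFull (cyclicOthers p i))).1 := by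
  have h := prod_mul_det_cycleMatrix (n + 2) (fun k => p (k + (i + 1))) fun _ => hp _
  rw [last_add_add_one, ← lapShift_cycleGraph] at h
  rw [cyclicOthers, ← h, ← Equiv.prod_comp (Equiv.addRight (i + 1)),
    ← Matrix.det_submatrix_equiv_self (Equiv.addRight (i + 1))]
  congr 2
  ext k l
  simp [lapShift_cycleGraph_add, Matrix.diagonal_apply]

end CycleMatrix

/-! ### Reduction of attached trees to weights on the cycle. -/

section Attach

variable {g : ℕ} {V : Fin g → Type*}

/-- The incidence matrix between the vertices of the family and the roots. -/
def rootMatrix (R : Type*) [CommRing R] [∀ i, DecidableEq (V i)] (r : ∀ i, V i) :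
    Matrix (Σ i, V i) (Fin g) R :=
  Matrix.of fun x j => if x.1 = j ∧ x.2 = r x.1 then 1 else 0

theorem cycleAttach_adj_same (T : ∀ i, SimpleGraph (V i)) (r : ∀ i, V i) (i : Fin g) (a b : V i) :
    (cycleAttach T r).Adj ⟨i, a⟩ ⟨i, b⟩ ↔ (T i).Adj a b := by
  constructor
  · rintro (⟨j, a', b', h, ha, hb⟩ | ⟨j, k, h, ha, hb⟩)
    · obtain rfl : i = j := congrArg Sigma.fst ha
      obtain rfl : a = a' := by simpa using ha
      obtain rfl : b = b' := by simpa using hb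
      exact h
    · obtain rfl : i = j := congrArg Sigma.fst ha
      obtain rfl : i = k := congrArg Sigma.fst hb
      exact absurd rfl h.ne
  · intro h
    exact Or.inl ⟨i, a, b, h, rfl, rfl⟩

theorem cycleAttach_adj_of_ne (T : ∀ i, SimpleGraph (V i)) (r : ∀ i, V i) {i j : Fin g}
    (hij : i ≠ j) (a : V i) (b : V j) :
    (cycleAttach T r).Adj ⟨i, a⟩ ⟨j, b⟩ ↔
      (SimpleGraph.cycleGraph g).Adj i j ∧ a = r i ∧ b = r j := by
  constructor
  · rintro (⟨k, a', b', h, ha, hb⟩ | ⟨k, l, h, ha, hb⟩)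
    · exact absurd ((congrArg Sigma.fst ha).trans (congrArg Sigma.fst hb).symm) hij
    · obtain rfl : i = k := congrArg Sigma.fst ha
      obtain rfl : j = l := congrArg Sigma.fst hb
      exact ⟨h, by simpa using ha, by simpa using hb⟩
  · rintro ⟨h, rfl, rfl⟩
    exact Or.inr ⟨i, j, h, rfl, rfl⟩

variable [∀ i, Fintype (V i)]

theorem det_blockDiagonal_sigma {R : Type*} [CommRing R] [∀ i, DecidableEq (V i)]
    (M : ∀ i, Matrix (V i) (V i) R) : (Matrix.blockDiagonal' M).det = ∏ i, (M i).det := by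
  have h : (Matrix.blockDiagonal' M).BlockTriangular Sigma.fst := by
    rintro ⟨i, a⟩ ⟨j, b⟩ hij
    exact Matrix.blockDiagonal'_apply_ne _ _ _ hij.ne'
  rw [h.det_fintype]
  refine Finset.prod_congr rfl fun i _ => ?_
  rw [← Matrix.det_submatrix_equiv_self (Equiv.sigmaSubtype i).symm]
  congr 1
  ext a b
  exact Matrix.blockDiagonal'_apply_eq M i a b

/-- The cycle acts on the roots only, and its shift is `0` because the blocks already contain `x`
for each root. -/
theorem lapShift_cycleAttach {R : Type*} [CommRing R] [∀ i, DecidableEq (V i)]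
    (T : ∀ i, SimpleGraph (V i)) (r : ∀ i, V i) (x : R) :
    lapShift (cycleAttach T r) x = Matrix.blockDiagonal' (fun i => lapShift (T i) x) +
      rootMatrix R r * (lapShift (SimpleGraph.cycleGraph g) (0 : R) * (rootMatrix R r).transpose) := by
  classical
  have hU : ∀ (Λ : Matrix (Fin g) (Fin g) R) (i j : Fin g) (a : V i) (b : V j),
      (rootMatrix R r * (Λ * (rootMatrix R r).transpose)) ⟨i, a⟩ ⟨j, b⟩ =
        if a = r i ∧ b = r j then Λ i j else 0 := by
    intro Λ i j a b
    by_cases ha : a = r i <;> by_cases hb : b = r j <;>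
      simp [rootMatrix, Matrix.mul_apply, ha, hb]
  ext ⟨i, a⟩ ⟨j, b⟩
  rw [Matrix.add_apply, hU]
  by_cases hij : i = j
  · subst hij
    rw [Matrix.blockDiagonal'_apply_eq]
    have hdeg : (∑ w, if (cycleAttach T r).Adj ⟨i, a⟩ w then (1 : R) else 0) =
        (∑ w, if (T i).Adj a w then 1 else 0) +
          if a = r i then (∑ k, if (SimpleGraph.cycleGraph g).Adj i k then 1 else 0) else 0 := by
      rw [Fintype.sum_sigma, ← Finset.add_sum_erase _ _ (Finset.mem_univ i)]
      congr 1
      · simp only [cycleAttach_adj_same]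
      · rw [← Finset.add_sum_erase _ (fun k => if (SimpleGraph.cycleGraph g).Adj i k then (1 : R)
          else 0) (Finset.mem_univ i)]
        rw [if_neg (SimpleGraph.irrefl _), zero_add]
        by_cases ha : a = r i
        · rw [if_pos ha]
          refine Finset.sum_congr rfl fun k hk => ?_
          simp only [cycleAttach_adj_of_ne T r (Finset.ne_of_mem_erase hk).symm, ha, true_and]
          by_cases hadj : (SimpleGraph.cycleGraph g).Adj i k <;> simp [hadj]
        · rw [if_neg ha]
          refine Finset.sum_eq_zero fun k hk => ?_
          simp [cycleAttach_adj_of_ne T r (Finset.ne_of_mem_erase hk).symm, ha]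
    simp only [lapShift, Matrix.of_apply, hdeg, cycleAttach_adj_same, Sigma.mk.injEq, heq_eq_eq,
      true_and, if_true, zero_add, SimpleGraph.irrefl, if_false, sub_zero]
    by_cases hab : a = b
    · subst hab
      simp only [if_true, and_self]
      split_ifs <;> ring_nf
    · have : ¬ (a = r i ∧ b = r i) := fun h => hab (h.1.trans h.2.symm)
      simp [hab, this]
  · rw [Matrix.blockDiagonal'_apply_ne _ _ _ hij]
    simp only [lapShift, Matrix.of_apply, cycleAttach_adj_of_ne T r hij, Sigma.mk.injEq, hij,
      false_and, if_false, zero_sub, zero_add]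
    split_ifs <;> simp_all

/-- The matrix determinant lemma reduces to size `g`: the inverse of the block matrix restricted to
the roots is diagonal with entries `h / φ`. -/
theorem det_blockDiagonal_add_rootMatrix {K : Type*} [Field K] [∀ i, DecidableEq (V i)]
    (N : ∀ i, Matrix (V i) (V i) K) (r : ∀ i, V i) (Λ : Matrix (Fin g) (Fin g) K)
    (hN : ∀ i, (N i).det ≠ 0) (hr : ∀ i, (N i).adjugate (r i) (r i) ≠ 0) :
    (Matrix.blockDiagonal' N + rootMatrix K r * (Λ * (rootMatrix K r).transpose)).det =
      (∏ i, (N i).adjugate (r i) (r i)) *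
        (Matrix.diagonal (fun i => (N i).det / (N i).adjugate (r i) (r i)) + Λ).det := by
  have hdet : (Matrix.blockDiagonal' N).det = ∏ i, (N i).det := det_blockDiagonal_sigma N
  have hunit : IsUnit (Matrix.blockDiagonal' N).det := by
    rw [hdet, isUnit_iff_ne_zero]
    exact Finset.prod_ne_zero_iff.2 fun i _ => hN i
  have hinv : (Matrix.blockDiagonal' N)⁻¹ = Matrix.blockDiagonal' fun i => (N i)⁻¹ := by
    refine Matrix.inv_eq_right_inv ?_
    rw [← Matrix.blockDiagonal'_mul]
    simp only [Matrix.mul_nonsing_inv _ (isUnit_iff_ne_zero.2 (hN _))]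
    exact Matrix.blockDiagonal'_one
  have hD : (rootMatrix K r).transpose * Matrix.blockDiagonal' (fun i => (N i)⁻¹) *
      rootMatrix K r = Matrix.diagonal fun i => (N i).adjugate (r i) (r i) / (N i).det := by
    have h1 : ∀ (M : Matrix (Σ i, V i) (Σ i, V i) K) (i j : Fin g),
        ((rootMatrix K r).transpose * M * rootMatrix K r) i j = M ⟨i, r i⟩ ⟨j, r j⟩ := by
      intro M i j
      simp only [rootMatrix, Matrix.mul_apply, Matrix.of_apply, Matrix.transpose_apply, ite_and,
        ite_mul, one_mul, zero_mul, mul_ite, mul_one, mul_zero, Fintype.sum_sigma]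
      rw [Finset.sum_eq_single j, Finset.sum_eq_single (r j), if_pos rfl, if_pos rfl,
        Finset.sum_eq_single i, Finset.sum_eq_single (r i), if_pos rfl, if_pos rfl]
      all_goals simp +contextual
    ext i j
    rw [h1]
    by_cases hij : i = j
    · subst hij
      rw [Matrix.blockDiagonal'_apply_eq, Matrix.diagonal_apply_eq, Matrix.inv_def]
      simp [div_eq_inv_mul]
    · rw [Matrix.blockDiagonal'_apply_ne _ _ _ hij, Matrix.diagonal_apply_ne _ hij]
  rw [Matrix.det_add_mul _ _ hunit, hdet, hinv, Matrix.mul_assoc Λ, Matrix.mul_assoc Λ, hD]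
  have hfac : 1 + Λ * Matrix.diagonal (fun i => (N i).adjugate (r i) (r i) / (N i).det) =
      (Matrix.diagonal (fun i => (N i).det / (N i).adjugate (r i) (r i)) + Λ) *
        Matrix.diagonal fun i => (N i).adjugate (r i) (r i) / (N i).det := by
    rw [Matrix.add_mul, Matrix.diagonal_mul_diagonal]
    congr 1
    rw [← Matrix.diagonal_one]
    congr 1
    funext i
    have h1 := hN i
    have h2 := hr i
    field_simp
  rw [hfac, Matrix.det_mul, Matrix.det_diagonal, mul_comm (Matrix.det _), ← mul_assoc,
    ← Finset.prod_mul_distrib]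
  congr 1
  refine Finset.prod_congr rfl fun i _ => ?_
  have h1 := hN i
  field_simp

end Attach

theorem lapPoly_cycleAttach {n : ℕ} {V : Fin (n + 3) → Type*} [∀ i, Fintype (V i)]
    (T : ∀ i, SimpleGraph (V i)) (r : ∀ i, V i) (hT : ∀ i, lapPoly (T i) ≠ 0)
    (hr : ∀ i, rootMinor (T i) (r i) ≠ 0) (i : Fin (n + 3)) :
    lapPoly (cycleAttach T r) = (glue (lapPoly (T i), rootMinor (T i) (r i))
      (cycleFull (cyclicOthers (fun i => (lapPoly (T i), rootMinor (T i) (r i))) i))).1 := by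
  classical
  -- The ratios `φ / h` need a field; injectivity brings the identity back to polynomials.
  set f := algebraMap ℤ[X] (FractionRing ℤ[X]) with hf
  have hinj : Function.Injective f := IsFractionRing.injective _ _
  have hmap : ∀ (U : Type _) [Fintype U] (G : SimpleGraph U),
      (lapShift G X).map f = lapShift G (f X) := by
    intro U _ G
    ext u v
    simp only [lapShift, Matrix.map_apply, Matrix.of_apply, map_sub, apply_ite f, map_add,
      map_sum, map_one, map_zero]
  have hdet : ∀ i, (lapShift (T i) (f X)).det = f (lapPoly (T i)) := by
    intro i
    rw [lapPoly_eq, RingHom.map_det, ← hmap]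
    rfl
  have hadj : ∀ i, (lapShift (T i) (f X)).adjugate (r i) (r i) = f (rootMinor (T i) (r i)) := by
    intro i
    rw [rootMinor_eq, ← hmap]
    exact (congrFun (congrFun (RingHom.map_adjugate f (lapShift (T i) X)) (r i)) (r i)).symm
  have h1 := det_blockDiagonal_add_rootMatrix (fun i => lapShift (T i) (f X)) r
    (lapShift (SimpleGraph.cycleGraph (n + 3)) 0)
    (fun i => by rw [hdet, ne_eq, map_eq_zero_iff f hinj]; exact hT i)
    (fun i => by rw [hadj, ne_eq, map_eq_zero_iff f hinj]; exact hr i)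
  rw [← lapShift_cycleAttach] at h1
  simp only [hdet, hadj] at h1
  have h2 := prod_mul_det_cycleGraph n
    (fun i => Prod.map f f (lapPoly (T i), rootMinor (T i) (r i)))
    (fun i => by
      change f _ ≠ 0
      rw [ne_eq, map_eq_zero_iff f hinj]; exact hr i) i
  apply hinj
  have h3 : f (lapPoly (cycleAttach T r)) = (lapShift (cycleAttach T r) (f X)).det := by
    rw [lapPoly_eq, RingHom.map_det, ← hmap]
    rfl
  have h4 : cyclicOthers (fun i => Prod.map f f (lapPoly (T i), rootMinor (T i) (r i))) i =
      (cyclicOthers (fun i => (lapPoly (T i), rootMinor (T i) (r i))) i).map (Prod.map f f) := by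
    simp only [cyclicOthers, List.map_ofFn]
    rfl
  rw [h3, h1]
  refine h2.trans ?_
  rw [h4, ← map_cycleFull, ← map_glue]
  rfl

/-! ### Polynomials of two graphs joined by an edge. -/

/-- The graph obtained from two graphs by adding an edge between `a` and `b`. -/
def bridge {V W : Type*} (G : SimpleGraph V) (H : SimpleGraph W) (a : V) (b : W) :
    SimpleGraph (V ⊕ W) where
  Adj x y :=
    match x, y with
    | .inl u, .inl v => G.Adj u v
    | .inr u, .inr v => H.Adj u v
    | .inl u, .inr v => u = a ∧ v = b
    | .inr v, .inl u => u = a ∧ v = b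
  symm := ⟨by
    rintro (u | u) (v | v) h
    · exact h.symm
    · exact h
    · exact h
    · exact h.symm⟩
  loopless := ⟨by
    rintro (u | u) h
    · exact G.irrefl h
    · exact H.irrefl h⟩

section BridgePolynomial

variable {V W : Type*} [Fintype V] [Fintype W] {R : Type*} [CommRing R]

theorem det_add_single_self [DecidableEq V] (A : Matrix V V R) (a : V) :
    (A + Matrix.single a a 1).det = A.det + A.adjugate a a := by
  have h : A + Matrix.single a a 1 = A.updateRow a (A a + Pi.single a 1) := by
    ext i j
    by_cases hi : i = a
    · subst hi; simp [Matrix.single_apply, Pi.single_apply, eq_comm]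
    · simp [hi, Ne.symm hi]
  rw [h, Matrix.det_updateRow_add, Matrix.updateRow_eq_self, Matrix.adjugate_apply]

/-- Split the row of `a` into its part from `A` and its part from the edge. The first determinant is
block triangular; in the second, adding this row to the row of `b` clears the lower left block. -/
theorem det_fromBlocks_edge [DecidableEq V] [DecidableEq W] (A : Matrix V V R)
    (D : Matrix W W R) (a : V) (b : W) :
    (Matrix.fromBlocks (A + Matrix.single a a 1) (-Matrix.single a b 1) (-Matrix.single b a 1)
      (D + Matrix.single b b 1)).det =
      A.det * (D.det + D.adjugate b b) + A.adjugate a a * D.det := by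
  set M := Matrix.fromBlocks (A + Matrix.single a a 1) (-Matrix.single a b 1)
    (-Matrix.single b a 1) (D + Matrix.single b b 1) with hM
  have h0 : M = M.updateRow (Sum.inl a) (Sum.elim (A a) 0 +
      Sum.elim (Pi.single a 1) (-Pi.single b 1)) := by
    ext i j
    by_cases hi : i = Sum.inl a
    · subst hi
      rcases j with j | j <;> simp [hM, Matrix.single_apply, Pi.single_apply, eq_comm]
    · simp [hi]
  have h1 : M.updateRow (Sum.inl a) (Sum.elim (A a) 0) =
      Matrix.fromBlocks A 0 (-Matrix.single b a 1) (D + Matrix.single b b 1) := by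
    ext i j
    by_cases hi : i = Sum.inl a
    · subst hi
      rcases j with j | j <;> simp
    · rcases i with i | i
      · have hi' : a ≠ i := fun h => hi (h ▸ rfl)
        rcases j with j | j <;> simp [hM, hi'.symm, hi']
      · rcases j with j | j <;> simp [hM]
  set M1 := M.updateRow (Sum.inl a) (Sum.elim (Pi.single a 1) (-Pi.single b 1)) with hM1
  have h2 : M1.updateRow (Sum.inr b) (M1 (Sum.inr b) + M1 (Sum.inl a)) =
      Matrix.fromBlocks (A.updateRow a (Pi.single a 1)) (-Matrix.single a b 1) 0 D := by
    ext i j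
    rcases i with i | i
    · by_cases hi : i = a
      · subst hi
        rcases j with j | j <;> simp [hM1, Matrix.single_apply, Pi.single_apply, eq_comm]
      · rcases j with j | j <;> simp [hM1, hM, hi, Ne.symm hi]
    · by_cases hi : i = b
      · subst hi
        rcases j with j | j <;>
          simp [hM1, hM, Matrix.single_apply, Pi.single_apply, eq_comm]
      · rcases j with j | j <;> simp [hM1, hM, hi, Ne.symm hi]
  rw [h0, Matrix.det_updateRow_add, h1, Matrix.det_fromBlocks_zero₁₂, det_add_single_self,
    ← hM1, ← Matrix.det_updateRow_add_self M1 (i := Sum.inr b) (j := Sum.inl a) (by simp), h2,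
    Matrix.det_fromBlocks_zero₂₁, ← Matrix.adjugate_apply]

theorem adjugate_fromBlocks_edge [DecidableEq V] [DecidableEq W] (A : Matrix V V R)
    (D : Matrix W W R) (a : V) (b : W) :
    (Matrix.fromBlocks (A + Matrix.single a a 1) (-Matrix.single a b 1) (-Matrix.single b a 1)
      (D + Matrix.single b b 1)).adjugate (Sum.inr b) (Sum.inr b) =
      (A.det + A.adjugate a a) * D.adjugate b b := by
  rw [← det_add_single_self, Matrix.adjugate_apply, Matrix.adjugate_apply,
    ← Matrix.det_fromBlocks_zero₂₁ _ (-Matrix.single a b 1)]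
  congr 1
  ext i j
  rcases i with i | i
  · rcases j with j | j <;> simp
  · by_cases hi : i = b
    · subst hi
      rcases j with j | j <;> simp [Pi.single_apply]
    · rcases j with j | j <;> simp [hi, Ne.symm hi]

open Classical in
theorem sum_bridge_adj_inl (G : SimpleGraph V) (H : SimpleGraph W) (a : V) (b : W) (i : V) :
    (∑ w, if (bridge G H a b).Adj (Sum.inl i) w then (1 : R) else 0) =
      (∑ w, if G.Adj i w then 1 else 0) + if i = a then 1 else 0 := by
  rw [Fintype.sum_sum_type]
  congr 1
  have h : ∀ w, (bridge G H a b).Adj (Sum.inl i) (Sum.inr w) ↔ i = a ∧ w = b := fun _ => Iff.rfl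
  simp only [h]
  by_cases h : i = a <;> simp [h]

open Classical in
theorem sum_bridge_adj_inr (G : SimpleGraph V) (H : SimpleGraph W) (a : V) (b : W) (i : W) :
    (∑ w, if (bridge G H a b).Adj (Sum.inr i) w then (1 : R) else 0) =
      (∑ w, if H.Adj i w then 1 else 0) + if i = b then 1 else 0 := by
  rw [Fintype.sum_sum_type, add_comm]
  congr 1
  have h : ∀ w, (bridge G H a b).Adj (Sum.inr i) (Sum.inl w) ↔ w = a ∧ i = b := fun _ => Iff.rfl
  simp only [h]
  by_cases h : i = b <;> simp [h]

open Classical in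
theorem lapShift_bridge (G : SimpleGraph V) (H : SimpleGraph W) (a : V) (b : W) (x : R) :
    lapShift (bridge G H a b) x =
      Matrix.fromBlocks (lapShift G x + Matrix.single a a 1) (-Matrix.single a b 1)
        (-Matrix.single b a 1) (lapShift H x + Matrix.single b b 1) := by
  have h1 : ∀ u v, (bridge G H a b).Adj (Sum.inl u) (Sum.inl v) ↔ G.Adj u v := fun _ _ => Iff.rfl
  have h2 : ∀ u v, (bridge G H a b).Adj (Sum.inl u) (Sum.inr v) ↔ u = a ∧ v = b :=
    fun _ _ => Iff.rfl
  have h3 : ∀ v u, (bridge G H a b).Adj (Sum.inr v) (Sum.inl u) ↔ u = a ∧ v = b :=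
    fun _ _ => Iff.rfl
  have h4 : ∀ u v, (bridge G H a b).Adj (Sum.inr u) (Sum.inr v) ↔ H.Adj u v := fun _ _ => Iff.rfl
  ext i j
  rcases i with i | i <;> rcases j with j | j
  · simp only [lapShift, Matrix.of_apply, Matrix.fromBlocks_apply₁₁, Matrix.add_apply,
      sum_bridge_adj_inl, h1, Sum.inl.injEq, Matrix.single_apply]
    by_cases hij : i = j
    · subst hij
      by_cases hi : i = a
      · simp only [hi, if_true, and_self]; ring
      · simp only [hi, Ne.symm hi, if_true, and_self, if_false]; ring
    · have : ¬ (a = i ∧ a = j) := fun h => hij (h.1.symm.trans h.2)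
      simp only [hij, if_false, this, add_zero]
  · simp [lapShift, h2, Matrix.single_apply, eq_comm]
  · simp [lapShift, h3, Matrix.single_apply, eq_comm, and_comm]
  · simp only [lapShift, Matrix.of_apply, Matrix.fromBlocks_apply₂₂, Matrix.add_apply,
      sum_bridge_adj_inr, h4, Sum.inr.injEq, Matrix.single_apply]
    by_cases hij : i = j
    · subst hij
      by_cases hi : i = b
      · simp only [hi, if_true, and_self]; ring
      · simp only [hi, Ne.symm hi, if_true, and_self, if_false]; ring
    · have : ¬ (b = i ∧ b = j) := fun h => hij (h.1.symm.trans h.2)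
      simp only [hij, if_false, this, add_zero]

theorem lapPoly_bridge (G : SimpleGraph V) (H : SimpleGraph W) (a : V) (b : W) :
    lapPoly (bridge G H a b) =
      lapPoly G * (lapPoly H + rootMinor H b) + rootMinor G a * lapPoly H := by
  classical
  rw [lapPoly_eq, lapShift_bridge, det_fromBlocks_edge, lapPoly_eq, lapPoly_eq, rootMinor_eq,
    rootMinor_eq]

theorem rootMinor_bridge (G : SimpleGraph V) (H : SimpleGraph W) (a : V) (b : W) :
    rootMinor (bridge G H a b) (Sum.inr b) = (lapPoly G + rootMinor G a) * rootMinor H b := by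
  classical
  rw [rootMinor_eq, lapShift_bridge, adjugate_fromBlocks_edge, lapPoly_eq, rootMinor_eq,
    rootMinor_eq]

end BridgePolynomial

/-! ### Forests as graphs. -/

namespace RForest

/-- The vertices of the rooted tree represented by the forest. -/
def Vert : RForest → Type
  | nil => Unit
  | cons c s => c.Vert ⊕ s.Vert

/-- The root of the rooted tree represented by the forest. -/
def root : (f : RForest) → f.Vert
  | nil => ()
  | cons _ s => Sum.inr s.root

/-- The rooted tree represented by the forest, as a graph. -/
def graph : (f : RForest) → SimpleGraph f.Vert
  | nil => ⊥
  | cons c s => bridge c.graph s.graph c.root s.root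

/-- The vertices form a finite type. -/
instance vertFintype : (f : RForest) → Fintype f.Vert
  | nil => inferInstanceAs (Fintype Unit)
  | cons c s => @instFintypeSum _ _ c.vertFintype s.vertFintype

theorem card_vert (f : RForest) : Fintype.card f.Vert = f.size + 1 := by
  induction f with
  | nil => rfl
  | cons c s hc hs =>
    have : Fintype.card (cons c s).Vert = Fintype.card c.Vert + Fintype.card s.Vert :=
      Fintype.card_sum
    rw [this, hc, hs, size]
    omega

/-- The algebraic recursion for pairs is exactly the bridge formula for `φ` and `h`. -/
theorem fullPair_pair (f : RForest) :
    fullPair f.pair = (lapPoly f.graph, rootMinor f.graph f.root) := by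
  induction f with
  | nil =>
    have h1 : lapPoly (graph nil) = X := by
      have : lapPoly (⊥ : SimpleGraph Unit) = X := by
        rw [lapPoly_eq, Matrix.det_unique]
        simp [lapShift]
      exact this
    have h2 : rootMinor (graph nil) (root nil) = 1 := by
      have : rootMinor (⊥ : SimpleGraph Unit) () = 1 := by
        rw [rootMinor_eq, Matrix.adjugate_subsingleton, Matrix.one_apply_eq]
      exact this
    rw [h1, h2]
    simp [fullPair, pairVal, pair]
  | cons c s hc hs =>
    have h1 : lapPoly (cons c s).graph = _ := lapPoly_bridge c.graph s.graph c.root s.root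
    have h2 : rootMinor (cons c s).graph (cons c s).root = _ :=
      rootMinor_bridge c.graph s.graph c.root s.root
    rw [h1, h2]
    simp only [Prod.ext_iff, fullPair] at hc hs
    rw [← hc.1, ← hc.2, ← hs.1, ← hs.2]
    ext1
    · simp only [fullPair, pairVal, pair, glue, hang]; ring
    · simp only [fullPair, pairVal, pair, glue, hang]

/-- The polynomial `det (x I + L)` of a cycle with attached rooted trees. -/
theorem lapPoly_cycleAttach_graph {n : ℕ} (f : Fin (n + 3) → RForest) (i : Fin (n + 3)) :
    lapPoly (cycleAttach (fun i => (f i).graph) fun i => (f i).root) =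
      pairVal (glue (cyclePair (cyclicOthers (fun i => (f i).pair) i)) (f i).pair) := by
  have h : ∀ i, (lapPoly (f i).graph, rootMinor (f i).graph (f i).root) = fullPair (f i).pair :=
    fun i => (fullPair_pair _).symm
  rw [lapPoly_cycleAttach (i := i)]
  · simp only [h]
    have : cyclicOthers (fun i => fullPair (f i).pair) i =
        (cyclicOthers (fun i => (f i).pair) i).map fullPair := by
      simp only [cyclicOthers, List.map_ofFn]
      rfl
    rw [this, cycleFull_fullPair]
    simp only [glue, fullPair, pairVal]
    ring
  · intro i
    rw [show lapPoly (f i).graph = pairVal (f i).pair from congrArg Prod.fst (h i)]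
    exact (f i).pairVal_pos.2
  · intro i
    rw [show rootMinor (f i).graph (f i).root = (f i).pair.2 from congrArg Prod.snd (h i)]
    exact (f i).pair_snd_pos.2

end RForest

/-! ### Rooted isomorphism and representation of trees by forests. -/

/-- The rooted graphs are isomorphic. -/
def RootedIso {V W : Type*} (G : SimpleGraph V) (a : V) (H : SimpleGraph W) (b : W) : Prop :=
  ∃ e : G ≃g H, e a = b

section RootedIso

variable {V W V' W' U : Type*} {G : SimpleGraph V} {H : SimpleGraph W} {G' : SimpleGraph V'}
  {H' : SimpleGraph W'} {F : SimpleGraph U} {a : V} {b : W} {a' : V'} {b' : W'} {c : U}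

theorem RootedIso.refl (G : SimpleGraph V) (a : V) : RootedIso G a G a :=
  ⟨SimpleGraph.Iso.refl, rfl⟩

theorem RootedIso.symm (h : RootedIso G a H b) : RootedIso H b G a := by
  obtain ⟨e, rfl⟩ := h
  exact ⟨e.symm, e.symm_apply_apply a⟩

theorem RootedIso.trans (h : RootedIso G a H b) (h' : RootedIso H b F c) :
    RootedIso G a F c := by
  obtain ⟨e, rfl⟩ := h
  obtain ⟨e', rfl⟩ := h'
  exact ⟨e.trans e', rfl⟩

theorem RootedIso.of_bijective (f : V → W) (hf : Function.Bijective f)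
    (h : ∀ x y, H.Adj (f x) (f y) ↔ G.Adj x y) (ha : f a = b) : RootedIso G a H b :=
  ⟨⟨Equiv.ofBijective f hf, h _ _⟩, ha⟩

theorem RootedIso.bridge (h : RootedIso G a G' a') (h' : RootedIso H b H' b') :
    RootedIso (bridge G H a b) (Sum.inr b) (bridge G' H' a' b') (Sum.inr b') := by
  obtain ⟨e, rfl⟩ := h
  obtain ⟨e', rfl⟩ := h'
  refine ⟨⟨Equiv.sumCongr e.toEquiv e'.toEquiv, ?_⟩, rfl⟩
  rintro (u | u) (v | v)
  · exact e.map_adj_iff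
  · exact and_congr e.injective.eq_iff e'.injective.eq_iff
  · exact and_congr e.injective.eq_iff e'.injective.eq_iff
  · exact e'.map_adj_iff

theorem rootedIso_bridge_assoc (G : SimpleGraph V) (H : SimpleGraph W) (F : SimpleGraph U)
    (a : V) (b b' : W) (c : U) :
    RootedIso (bridge (bridge G H a b) F (Sum.inr b') c) (Sum.inr c)
      (bridge G (bridge H F b' c) a (Sum.inl b)) (Sum.inr (Sum.inr c)) := by
  refine ⟨⟨Equiv.sumAssoc V W U, ?_⟩, rfl⟩
  rintro ((u | u) | u) ((v | v) | v) <;>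
    simp [bridge, Equiv.sumAssoc]

/-- Two branches of the same root change places; this gives independence of the order of children.
-/
theorem rootedIso_bridge_left_comm (G : SimpleGraph V) (H : SimpleGraph W) (F : SimpleGraph U)
    (a : V) (b : W) (c c' : U) :
    RootedIso (bridge G (bridge H F b c) a (Sum.inr c')) (Sum.inr (Sum.inr c'))
      (bridge H (bridge G F a c') b (Sum.inr c)) (Sum.inr (Sum.inr c')) := by
  refine ⟨⟨⟨Sum.elim (Sum.inr ∘ Sum.inl) (Sum.elim Sum.inl (Sum.inr ∘ Sum.inr)),
    Sum.elim (Sum.inr ∘ Sum.inl) (Sum.elim Sum.inl (Sum.inr ∘ Sum.inr)), ?_, ?_⟩, ?_⟩, rfl⟩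
  · rintro (u | u | u) <;> rfl
  · rintro (u | u | u) <;> rfl
  · rintro (u | u | u) (v | v | v) <;> simp [bridge]

theorem RootedIso.leafCount_eq (h : RootedIso G a H b) : leafCount G a = leafCount H b := by
  obtain ⟨e, rfl⟩ := h
  unfold leafCount
  rw [← Set.ncard_image_of_injective _ e.injective]
  congr 1
  ext w
  obtain ⟨v, rfl⟩ := e.surjective w
  have h : H.neighborSet (e v) = e '' G.neighborSet v := by
    ext x
    obtain ⟨y, rfl⟩ := e.surjective x
    simp [e.map_adj_iff]
  rw [e.injective.mem_set_image, Set.mem_ofPred_eq, Set.mem_ofPred_eq, h,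
    Set.ncard_image_of_injective _ e.injective, e.injective.ne_iff]

end RootedIso

theorem rootedIso_bridge_of_leaf {V : Type*} {T : SimpleGraph V} {v u : V} (huv : T.Adj v u)
    (hu : ∀ w, T.Adj v w → w = u) (r : V) (hr : r ∈ ({v}ᶜ : Set V)) :
    RootedIso T r (bridge (⊥ : SimpleGraph Unit) (T.induce ({v}ᶜ : Set V)) ()
      ⟨u, fun h => huv.ne h.symm⟩) (Sum.inr ⟨r, hr⟩) := by
  apply RootedIso.symm
  let f : Unit ⊕ ({v}ᶜ : Set V) → V := Sum.elim (fun _ => v) Subtype.val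
  have hf : Function.Bijective f := by
    constructor
    · rintro (x | x) (y | y) h
      · rfl
      · exact absurd h.symm y.2
      · exact absurd h x.2
      · exact congrArg Sum.inr (Subtype.ext h)
    · intro w
      by_cases hw : w = v
      · exact ⟨Sum.inl (), hw.symm⟩
      · exact ⟨Sum.inr ⟨w, hw⟩, rfl⟩
  refine ⟨⟨Equiv.ofBijective f hf, ?_⟩, rfl⟩
  have h1 : ∀ y : ({v}ᶜ : Set V), T.Adj v y ↔ y = ⟨u, fun h => huv.ne h.symm⟩ := fun y =>
    ⟨fun h => Subtype.ext (hu _ h), fun h => h ▸ huv⟩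
  rintro (x | x) (y | y)
  · simp [f, bridge]
  · simpa [f, bridge] using h1 y
  · simpa [f, bridge, T.adj_comm] using h1 x
  · simp [f, bridge]

namespace RForest

/-- This is the inductive step for representing trees: a removed leaf can be put back at any vertex.
-/
theorem exists_rootedIso_bridge_leaf (f : RForest) (w : f.Vert) :
    ∃ f' : RForest, RootedIso f'.graph f'.root
      (bridge (⊥ : SimpleGraph Unit) f.graph () w) (Sum.inr f.root) := by
  induction f with
  | nil => exact ⟨cons nil nil, RootedIso.refl _ _⟩
  | cons c s hc hs =>
    rcases w with w | w
    · obtain ⟨c', h⟩ := hc w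
      exact ⟨cons c' s, (h.bridge (RootedIso.refl s.graph s.root)).trans
        (rootedIso_bridge_assoc _ _ _ _ _ _ _)⟩
    · obtain ⟨s', h⟩ := hs w
      exact ⟨cons c s', ((RootedIso.refl c.graph c.root).bridge h).trans
        (rootedIso_bridge_left_comm _ _ _ _ _ _ _)⟩

/-- Every finite rooted tree is represented by a forest. -/
theorem exists_rootedIso_graph (N : ℕ) {V : Type*} [Fintype V] (hN : Fintype.card V = N)
    (T : SimpleGraph V) (r : V) (hT : T.IsTree) :
    ∃ f : RForest, RootedIso f.graph f.root T r := by
  classical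
  induction N generalizing V with
  | zero => exact ((Fintype.card_eq_zero_iff.1 hN).false r).elim
  | succ N ih =>
    rcases subsingleton_or_nontrivial V with hV | hV
    · refine ⟨nil, ⟨⟨⟨fun _ => r, fun _ => (), fun _ => rfl, fun _ => Subsingleton.elim _ _⟩, ?_⟩,
        rfl⟩⟩
      intro x y
      exact iff_of_false (fun h => h.ne rfl) (fun h => h)
    -- Of two vertices of degree one, at least one differs from the root, so the root survives the
    -- removal.
    · obtain ⟨v, hvr, hv⟩ : ∃ v, v ≠ r ∧ T.degree v = 1 := by
        obtain ⟨v, w, hvw, hv, hw⟩ := hT.exists_ne_and_degree_eq_one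
        by_cases h : v = r
        · exact ⟨w, fun h' => hvw (h.trans h'.symm), hw⟩
        · exact ⟨v, h, hv⟩
      have hconn := hT.1.induce_compl_singleton_of_degree_eq_one hv
      have hT' : (T.induce ({v}ᶜ : Set V)).IsTree := ⟨hconn, hT.2.induce _⟩
      have hcard : Fintype.card ({v}ᶜ : Set V) = N := by
        rw [Fintype.card_compl_set, hN]; simp
      obtain ⟨u, huv, hu⟩ := SimpleGraph.degree_eq_one_iff_existsUnique_adj.1 hv
      obtain ⟨f, e, he⟩ := ih hcard _ ⟨r, hvr.symm⟩ hT'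
      obtain ⟨f', hf'⟩ := exists_rootedIso_bridge_leaf f (e.symm ⟨u, fun h => huv.ne h.symm⟩)
      refine ⟨f', hf'.trans (RootedIso.trans ?_ (rootedIso_bridge_of_leaf huv hu r hvr.symm).symm)⟩
      refine ⟨⟨Equiv.sumCongr (Equiv.refl Unit) e.toEquiv, ?_⟩, congrArg Sum.inr he⟩
      rintro (x | x) (y | y)
      · exact Iff.rfl
      · exact and_congr Iff.rfl e.toEquiv.eq_symm_apply.symm
      · exact and_congr Iff.rfl e.toEquiv.eq_symm_apply.symm
      · exact e.map_adj_iff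

end RForest

/-! ### Counting leaves. -/

section LeafCount

variable {V W : Type*}

theorem ncard_neighborSet_bridge_inr (G : SimpleGraph V) (H : SimpleGraph W) (a : V) {b w : W}
    (hw : w ≠ b) :
    ((bridge G H a b).neighborSet (Sum.inr w)).ncard = (H.neighborSet w).ncard := by
  have h : (bridge G H a b).neighborSet (Sum.inr w) = Sum.inr '' H.neighborSet w := by
    ext (x | x) <;> simp [bridge, hw]
  rw [h, Set.ncard_image_of_injective _ Sum.inr_injective]

variable [Finite V] [Finite W]

theorem ncard_neighborSet_bridge_inl (G : SimpleGraph V) (H : SimpleGraph W) (a : V) (b : W)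
    (v : V) :
    ((bridge G H a b).neighborSet (Sum.inl v)).ncard =
      (G.neighborSet v).ncard + {w : W | v = a ∧ w = b}.ncard := by
  have h : (bridge G H a b).neighborSet (Sum.inl v) =
      Sum.inl '' G.neighborSet v ∪ Sum.inr '' {w : W | v = a ∧ w = b} := by
    ext (x | x) <;> simp [bridge]
  rw [h, Set.ncard_union_eq, Set.ncard_image_of_injective _ Sum.inl_injective,
    Set.ncard_image_of_injective _ Sum.inr_injective]
  rw [Set.disjoint_left]
  rintro _ ⟨x, _, rfl⟩ ⟨y, _, h⟩
  cases h

/-- The middle term counts `a` when it is isolated in `G`, as the new edge then makes it a leaf. It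
accounts for `max 1` in `leaves`. -/
theorem leafCount_bridge (G : SimpleGraph V) (H : SimpleGraph W) (a : V) (b : W) :
    leafCount (bridge G H a b) (Sum.inr b) =
      leafCount G a + {v : V | v = a ∧ G.neighborSet a = ∅}.ncard + leafCount H b := by
  have h : {x : V ⊕ W | x ≠ Sum.inr b ∧ ((bridge G H a b).neighborSet x).ncard = 1} =
      Sum.inl '' ({v : V | v ≠ a ∧ (G.neighborSet v).ncard = 1} ∪
        {v : V | v = a ∧ G.neighborSet a = ∅}) ∪
      Sum.inr '' {w : W | w ≠ b ∧ (H.neighborSet w).ncard = 1} := by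
    ext (v | w)
    · rw [Set.mem_union, Sum.inl_injective.mem_set_image, Set.mem_ofPred_eq,
        ncard_neighborSet_bridge_inl, Set.mem_union, Set.mem_ofPred_eq, Set.mem_ofPred_eq]
      have h2 : Sum.inl v ∉ Sum.inr '' {w : W | w ≠ b ∧ (H.neighborSet w).ncard = 1} := by
        rintro ⟨_, _, h⟩
        cases h
      rw [or_iff_left h2, and_iff_right Sum.inl_ne_inr]
      by_cases hv : v = a
      · subst hv
        rw [← Set.ncard_eq_zero]
        simp only [true_and, ne_eq, not_true_eq_false, false_and, false_or]
        rw [Set.ofPred_eq_eq_singleton, Set.ncard_singleton]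
        omega
      · simp only [hv, false_and, Set.ofPred_false, Set.ncard_empty, ne_eq, not_false_eq_true,
          true_and, or_false, add_zero]
    · rw [Set.mem_union, Sum.inr_injective.mem_set_image, Set.mem_ofPred_eq, Set.mem_ofPred_eq]
      have h2 : (Sum.inr w : V ⊕ W) ∉ Sum.inl '' ({v : V | v ≠ a ∧ (G.neighborSet v).ncard = 1} ∪
          {v : V | v = a ∧ G.neighborSet a = ∅}) := by
        rintro ⟨_, _, h⟩
        cases h
      rw [or_iff_right h2, Sum.inr_injective.ne_iff]
      exact and_congr_right fun hw => by rw [ncard_neighborSet_bridge_inr G H a hw]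
  unfold leafCount
  rw [h, Set.ncard_union_eq, Set.ncard_image_of_injective _ Sum.inl_injective,
    Set.ncard_image_of_injective _ Sum.inr_injective, Set.ncard_union_eq]
  · rw [Set.disjoint_left]
    rintro x ⟨h1, _⟩ ⟨h2, _⟩
    exact h1 h2
  · rw [Set.disjoint_left]
    rintro _ ⟨x, _, rfl⟩ ⟨y, _, h⟩
    cases h

end LeafCount

/-! ### Paths, starlike trees and stems as forests. -/

namespace RForest

theorem neighborSet_root_eq_empty (f : RForest) : f.graph.neighborSet f.root = ∅ ↔ f = nil := by
  cases f with
  | nil =>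
    refine iff_of_true ?_ rfl
    ext x
    exact iff_of_false (fun h => h) (fun h => h)
  | cons c s =>
    refine iff_of_false (fun h => ?_) (by simp)
    have : Sum.inl c.root ∈ (cons c s).graph.neighborSet (cons c s).root :=
      show c.root = c.root ∧ s.root = s.root from ⟨rfl, rfl⟩
    rw [h] at this
    exact this

theorem leafCount_graph (f : RForest) : leafCount f.graph f.root = f.leaves := by
  induction f with
  | nil =>
    have : {v : Unit | v ≠ () ∧ ((⊥ : SimpleGraph Unit).neighborSet v).ncard = 1} = ∅ := by
      ext x; simp
    change Set.ncard {v : Unit | v ≠ () ∧ ((⊥ : SimpleGraph Unit).neighborSet v).ncard = 1} = 0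
    rw [this, Set.ncard_empty]
  | cons c s hc hs =>
    have h : leafCount (cons c s).graph (cons c s).root = _ :=
      leafCount_bridge c.graph s.graph c.root s.root
    rw [h, hc, hs, leaves]
    congr 1
    by_cases hn : c = nil
    · have : {v | v = c.root ∧ c.graph.neighborSet c.root = ∅} = {c.root} := by
        ext v
        exact and_iff_left ((neighborSet_root_eq_empty c).2 hn)
      rw [this, Set.ncard_singleton, hn, leaves]
      rfl
    · have : {v | v = c.root ∧ c.graph.neighborSet c.root = ∅} = ∅ := by
        ext v
        exact iff_of_false (fun h => hn ((neighborSet_root_eq_empty c).1 h.2)) (fun h => h)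
      rw [this, Set.ncard_empty, add_zero, max_eq_right (leaves_pos hn)]

theorem rootedIso_ofTrees_of_perm {l l' : List RForest} (h : l.Perm l') :
    RootedIso (ofTrees l).graph (ofTrees l).root (ofTrees l').graph (ofTrees l').root := by
  induction h with
  | nil => exact RootedIso.refl _ _
  | cons x _ ih => exact (RootedIso.refl x.graph x.root).bridge ih
  | swap x y l => exact rootedIso_bridge_left_comm _ _ _ _ _ _ _
  | trans _ _ h1 h2 => exact h1.trans h2

theorem rootedIso_bridge_pathGraph (m : ℕ) :
    RootedIso (bridge (SimpleGraph.pathGraph (m + 1)) (⊥ : SimpleGraph Unit) 0 ()) (Sum.inr ())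
      (SimpleGraph.pathGraph (m + 2)) 0 := by
  refine RootedIso.of_bijective (Sum.elim Fin.succ fun _ => 0) ⟨?_, ?_⟩ ?_ rfl
  · rintro (x | x) (y | y) h
    · exact congrArg Sum.inl (Fin.succ_injective _ h)
    · exact absurd h (Fin.succ_ne_zero x)
    · exact absurd h.symm (Fin.succ_ne_zero y)
    · rfl
  · intro x
    obtain rfl | ⟨y, rfl⟩ := x.eq_zero_or_eq_succ
    · exact ⟨Sum.inr (), rfl⟩
    · exact ⟨Sum.inl y, rfl⟩
  · rintro (x | x) (y | y)
    · simp [bridge, SimpleGraph.pathGraph_adj]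
    · change _ ↔ x = 0 ∧ y = ()
      rw [SimpleGraph.pathGraph_adj, and_iff_left rfl, Fin.ext_iff]
      simp only [Sum.elim_inl, Sum.elim_inr, Fin.val_succ, Fin.val_zero]
      omega
    · change _ ↔ y = 0 ∧ x = ()
      rw [SimpleGraph.pathGraph_adj, and_iff_left rfl, Fin.ext_iff]
      simp only [Sum.elim_inl, Sum.elim_inr, Fin.val_succ, Fin.val_zero]
      omega
    · simp [bridge]

theorem rootedIso_pathGraph_succ (m : ℕ) :
    RootedIso (SimpleGraph.pathGraph (m + 1)) 0 (path m).graph (path m).root := by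
  induction m with
  | zero =>
    refine ⟨⟨⟨fun _ => (), fun _ => 0, fun _ => Fin.ext (by omega), fun _ => rfl⟩, ?_⟩, rfl⟩
    intro x y
    exact iff_of_false (fun h => h) (fun h => h.ne (Fin.ext (by omega)))
  | succ m ih =>
    exact (rootedIso_bridge_pathGraph m).symm.trans
      (ih.bridge (RootedIso.refl (⊥ : SimpleGraph Unit) ()))

theorem rootedIso_pathGraph {m : ℕ} (h : 0 < m) :
    RootedIso (SimpleGraph.pathGraph m) ⟨0, h⟩ (path (m - 1)).graph (path (m - 1)).root := by
  obtain ⟨m, rfl⟩ := Nat.exists_eq_succ_of_ne_zero h.ne'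
  exact rootedIso_pathGraph_succ m

theorem rootedIso_starlike_succ {l : ℕ} (a : Fin (l + 1) → ℕ) (h : 0 < a 0) :
    RootedIso (bridge (SimpleGraph.pathGraph (a 0)) (starlike (Fin.tail a)) ⟨0, h⟩ none)
      (Sum.inr none) (starlike a) none := by
  let f : Fin (a 0) ⊕ StarVert (Fin.tail a) → StarVert a :=
    Sum.elim (fun k => some ⟨0, k⟩) (Option.map fun x => ⟨x.1.succ, x.2⟩)
  have hinj : Function.Injective f := by
    rintro (x | _ | ⟨j, x⟩) (y | _ | ⟨k, y⟩) h
    · have h := Option.some_injective _ h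
      rw [Sigma.mk.inj_iff] at h
      exact congrArg Sum.inl (eq_of_heq h.2)
    · cases h
    · exact absurd (congrArg Sigma.fst (Option.some_injective _ h)).symm (Fin.succ_ne_zero _)
    · cases h
    · rfl
    · cases h
    · exact absurd (congrArg Sigma.fst (Option.some_injective _ h)) (Fin.succ_ne_zero _)
    · cases h
    · have h := Option.some_injective _ h
      obtain rfl := Fin.succ_injective _ (congrArg Sigma.fst h)
      obtain rfl : x = y := eq_of_heq (Sigma.mk.inj_iff.1 h).2
      rfl
  refine RootedIso.of_bijective f ⟨hinj, ?_⟩ ?_ rfl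
  · rintro (_ | ⟨j, x⟩)
    · exact ⟨Sum.inr none, rfl⟩
    · obtain rfl | ⟨k, rfl⟩ := j.eq_zero_or_eq_succ
      · exact ⟨Sum.inl x, rfl⟩
      · exact ⟨Sum.inr (some ⟨k, x⟩), rfl⟩
  intro x y
  unfold starlike
  rw [SimpleGraph.fromRel_adj, hinj.ne_iff]
  rcases x with (x | _ | ⟨j, x⟩) <;> rcases y with (y | _ | ⟨k, y⟩)
  · simp [f, bridge, SimpleGraph.pathGraph_adj, Fin.ext_iff]
    omega
  · simp [f, bridge, Fin.ext_iff]
  · simp [f, bridge, (Fin.succ_ne_zero _).symm, Fin.succ_ne_zero]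
  · simp [f, bridge, Fin.ext_iff]
  · simp [f, bridge]
  · simp [f, bridge, SimpleGraph.fromRel_adj]
  · simp [f, bridge, (Fin.succ_ne_zero _).symm, Fin.succ_ne_zero]
  · simp [f, bridge, SimpleGraph.fromRel_adj]
  · simp [f, bridge, SimpleGraph.fromRel_adj]

/-- One of the `a j` edges of a leg is the one that hangs it from the center, so the branch itself
is a path with `a j - 1` edges. -/
theorem rootedIso_starlike {l : ℕ} (a : Fin l → ℕ) (h : ∀ j, 0 < a j) :
    RootedIso (starlike a) none (paths (List.ofFn fun j => a j - 1)).graph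
      (paths (List.ofFn fun j => a j - 1)).root := by
  induction l with
  | zero =>
    refine ⟨⟨⟨fun _ => (), fun _ => none, fun x => ?_, fun _ => rfl⟩, ?_⟩, rfl⟩
    · rcases x with _ | ⟨j, _⟩
      · rfl
      · exact j.elim0
    · intro x y
      refine iff_of_false (fun h => h) (fun h => h.ne ?_)
      rcases x with _ | ⟨j, _⟩
      · rcases y with _ | ⟨j, _⟩
        · rfl
        · exact j.elim0
      · exact j.elim0
  | succ l ih =>
    rw [List.ofFn_succ]
    exact (rootedIso_starlike_succ a (h 0)).symm.trans
      ((rootedIso_pathGraph (h 0)).bridge (ih (Fin.tail a) fun j => h _))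

theorem rootedIso_bridge_prependPath {W : Type*} (H : SimpleGraph W) (c : W) (q : ℕ) :
    RootedIso (bridge (prependPath q H c) (⊥ : SimpleGraph Unit) (prependPathRoot q c) ())
      (Sum.inr ()) (prependPath (q + 1) H c) (prependPathRoot (q + 1) c) := by
  let g : (Fin q ⊕ W) ⊕ Unit → Fin (q + 1) ⊕ W :=
    Sum.elim (Sum.map Fin.succ id) fun _ => Sum.inl 0
  have hg : Function.Injective g := by
    rintro ((x | x) | x) ((y | y) | y) h
    · rw [Fin.succ_injective _ (Sum.inl_injective h)]
    · cases h
    · exact absurd (Sum.inl_injective h) (Fin.succ_ne_zero _)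
    · cases h
    · cases h
      rfl
    · cases h
    · exact absurd (Sum.inl_injective h).symm (Fin.succ_ne_zero _)
    · cases h
    · rfl
  -- For `q = 0` the root of the path is `c` itself; this form treats both cases at once.
  have hroot : ∀ z : Fin q ⊕ W, z = prependPathRoot q c ↔
      (∃ i : Fin q, z = Sum.inl i ∧ i.val = 0) ∨ (z = Sum.inr c ∧ q = 0) := by
    intro z
    unfold prependPathRoot
    split_ifs with hq
    · constructor
      · rintro rfl
        exact Or.inl ⟨_, rfl, rfl⟩
      · rintro (⟨i, rfl, hi⟩ | ⟨_, h⟩)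
        · exact congrArg Sum.inl (Fin.ext hi)
        · omega
    · constructor
      · rintro rfl
        exact Or.inr ⟨rfl, by omega⟩
      · rintro (⟨i, _, _⟩ | ⟨h, _⟩)
        · exact absurd i.pos hq
        · exact h
  refine RootedIso.of_bijective g ⟨hg, ?_⟩ ?_ ?_
  · rintro (x | x)
    · obtain rfl | ⟨y, rfl⟩ := x.eq_zero_or_eq_succ
      · exact ⟨Sum.inr (), rfl⟩
      · exact ⟨Sum.inl (Sum.inl y), rfl⟩
    · exact ⟨Sum.inl (Sum.inr x), rfl⟩
  · intro x y
    unfold prependPath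
    rw [SimpleGraph.fromRel_adj, hg.ne_iff]
    rcases x with ((x | x) | x) <;> rcases y with ((y | y) | y)
    · simp [g, bridge]
    · simp [g, bridge]
    · simp [g, bridge, hroot, eq_comm]
    · simp [g, bridge]
    · simp [g, bridge]
    · simp [g, bridge, hroot, and_comm, eq_comm]
    · simp [g, bridge, hroot, eq_comm]
    · simp [g, bridge, hroot, and_comm, eq_comm]
    · simp [g, bridge]
  · simp [g, prependPathRoot]

theorem rootedIso_prependPath {W : Type*} {H : SimpleGraph W} {c : W} {f : RForest}
    (h : RootedIso H c f.graph f.root) (q : ℕ) :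
    RootedIso (prependPath q H c) (prependPathRoot q c) (stretch q f).graph (stretch q f).root := by
  induction q with
  | zero =>
    refine RootedIso.trans (RootedIso.symm ?_) h
    refine ⟨⟨(Equiv.emptySum (Fin 0) W).symm, ?_⟩, rfl⟩
    intro x y
    simp only [prependPath, SimpleGraph.fromRel_adj, Equiv.emptySum_symm_apply]
    constructor
    · rintro ⟨_, h | h⟩
      · exact h
      · exact h.symm
    · intro h
      exact ⟨fun h' => h.ne (Sum.inr_injective h'), Or.inl h⟩
  | succ q ih =>
    exact (rootedIso_bridge_prependPath H c q).symm.trans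
      (ih.bridge (RootedIso.refl (⊥ : SimpleGraph Unit) ()))

end RForest

/-! ### Almost constant lists. -/

section BalancedLists

theorem sum_eq_of_mem_pair {L : List ℕ} {m : ℕ} (h : ∀ a ∈ L, a = m ∨ a = m + 1) :
    L.sum = m * L.length + L.count (m + 1) ∧ L.count m + L.count (m + 1) = L.length := by
  induction L with
  | nil => simp
  | cons a L ih =>
    obtain ⟨h1, h2⟩ := ih fun b hb => h b (List.mem_cons_of_mem _ hb)
    rcases h a List.mem_cons_self with rfl | rfl
    · simp only [List.sum_cons, List.length_cons, List.count_cons, h1, mul_add, ← h2]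
      simp
      omega
    · simp only [List.sum_cons, List.length_cons, List.count_cons, h1, mul_add, ← h2]
      simp
      omega

/-- With `m` the minimum, the strict bound makes `m` and the number of entries `m + 1` the quotient
and remainder of the sum by the length. -/
theorem exists_mem_pair {L : List ℕ} (h : ∀ a ∈ L, ∀ b ∈ L, a ≤ b + 1) (hL : L ≠ []) :
    ∃ m, (∀ a ∈ L, a = m ∨ a = m + 1) ∧ L.count (m + 1) < L.length := by
  classical
  have hex : ∃ m, m ∈ L := List.exists_mem_of_ne_nil L hL
  have hm := Nat.find_spec hex
  have hmin : ∀ a ∈ L, Nat.find hex ≤ a := fun a ha => Nat.find_min' hex ha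
  generalize Nat.find hex = m at hm hmin
  have h1 : ∀ a ∈ L, a = m ∨ a = m + 1 := fun a ha => by
    have := hmin a ha
    have := h a ha m hm
    omega
  have h2 := (sum_eq_of_mem_pair h1).2
  have h3 := List.count_pos_iff.2 hm
  exact ⟨m, h1, by omega⟩

/-- A list of almost equal natural numbers is determined by its length and its sum, up to order. -/
theorem perm_of_sum_eq {L L' : List ℕ} (h : ∀ a ∈ L, ∀ b ∈ L, a ≤ b + 1)
    (h' : ∀ a ∈ L', ∀ b ∈ L', a ≤ b + 1) (hlen : L.length = L'.length) (hsum : L.sum = L'.sum) :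
    L.Perm L' := by
  by_cases hL : L = []
  · subst hL
    rw [List.length_eq_zero_iff.1 hlen.symm]
  have hL' : L' ≠ [] := fun h => hL (List.length_eq_zero_iff.1 (hlen.trans (h ▸ rfl)))
  obtain ⟨m, hm, hc⟩ := exists_mem_pair h hL
  obtain ⟨m', hm', hc'⟩ := exists_mem_pair h' hL'
  obtain ⟨h1, h2⟩ := sum_eq_of_mem_pair hm
  obtain ⟨h1', h2'⟩ := sum_eq_of_mem_pair hm'
  have hmm : m = m' := by
    rw [← hlen] at h1' hc'
    rcases lt_trichotomy m m' with hlt | rfl | hlt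
    · nlinarith [Nat.mul_le_mul_right L.length hlt]
    · rfl
    · nlinarith [Nat.mul_le_mul_right L.length hlt]
  subst hmm
  rw [hlen] at h1 h2
  rw [List.perm_iff_count]
  intro a
  by_cases ha : a = m
  · subst ha
    omega
  by_cases ha' : a = m + 1
  · subst ha'
    omega
  rw [List.count_eq_zero.2 fun h => (hm a h).elim ha ha',
    List.count_eq_zero.2 fun h => (hm' a h).elim ha ha']

end BalancedLists

/-! ### Normal form of balanced trees. -/

namespace RForest

theorem size_path (k : ℕ) : (path k).size = k := by
  induction k with
  | zero => rfl
  | succ k ih => rw [path, size, ih, size]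

theorem size_paths (L : List ℕ) : (paths L).size = L.sum + L.length := by
  unfold paths
  induction L with
  | nil => rfl
  | cons a L ih =>
    rw [List.map_cons, ofTrees, size, size_path, ih, List.sum_cons, List.length_cons]
    omega

theorem leaves_paths (L : List ℕ) : (paths L).leaves = L.length := by
  unfold paths
  induction L with
  | nil => rfl
  | cons a L ih =>
    rw [List.map_cons, ofTrees, leaves, max_eq_left (leaves_path a), ih, List.length_cons]
    omega

theorem size_stretch (q : ℕ) (f : RForest) : (stretch q f).size = q + f.size := by
  induction q with
  | zero => rw [stretch, zero_add]
  | succ q ih => rw [stretch, size, ih, size]; omega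

theorem leaves_stretch (q : ℕ) {f : RForest} (h : 1 ≤ f.leaves) :
    (stretch q f).leaves = f.leaves := by
  induction q with
  | zero => rfl
  | succ q ih => rw [stretch, leaves, ih, max_eq_right h, leaves, add_zero]

theorem stretch_path (q k : ℕ) : stretch q (path k) = path (q + k) := by
  induction q with
  | zero => rw [zero_add]; rfl
  | succ q ih => rw [stretch, ih, Nat.succ_add]; rfl

theorem paths_singleton (k : ℕ) : paths [k] = path (k + 1) := rfl

/-- A stem followed by at most one leg is a path, and it is rewritten as a single leg without stem.
Otherwise `p` would not be `1` for such trees. -/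
theorem IsBalanced.exists_eq {f : RForest} (h : f.IsBalanced) :
    ∃ q L, f = stretch q (paths L) ∧ (∀ a ∈ L, ∀ b ∈ L, a ≤ b + 1) ∧
      (q = 0 ∨ 2 ≤ L.length) := by
  obtain ⟨q, L, rfl, hL⟩ := h
  rcases L with _ | ⟨a, _ | ⟨b, L⟩⟩
  · cases q with
    | zero => exact ⟨0, [], rfl, by simp, Or.inl rfl⟩
    | succ q => exact ⟨0, [q], stretch_path (q + 1) 0, by simp, Or.inl rfl⟩
  · refine ⟨0, [q + a], ?_, by simp, Or.inl rfl⟩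
    rw [paths_singleton, stretch_path]
    rfl
  · exact ⟨q, a :: b :: L, rfl, hL, Or.inr (by simp)⟩

theorem hasStem_stretch {q : ℕ} (hq : q ≠ 0) {L : List ℕ} (hL : 2 ≤ L.length) :
    (stretch q (paths L)).HasStem := by
  obtain ⟨q, rfl⟩ := Nat.exists_eq_succ_of_ne_zero hq
  refine ⟨stretch q (paths L), rfl, fun ⟨k, hk⟩ => ?_⟩
  have h1 := leaves_path k
  rw [← hk, leaves_stretch q (by rw [leaves_paths]; omega), leaves_paths] at h1
  omega

theorem rootedIso_BST {L : List ℕ} (hL : ∀ a ∈ L, ∀ b ∈ L, a ≤ b + 1) {m : ℕ}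
    (hm : m = (paths L).size + 1) :
    RootedIso (BST m L.length) none (paths L).graph (paths L).root := by
  rw [size_paths] at hm
  -- Here `m - 1` is the sum of `L` plus its length, hence at least the number of legs.
  have hpos : ∀ j, 0 < legLength m L.length j := fun j =>
    Nat.add_pos_left (Nat.div_pos (by omega) j.pos) _
  refine (rootedIso_starlike _ hpos).trans (rootedIso_ofTrees_of_perm (List.Perm.map _ ?_))
  refine perm_of_sum_eq ?_ hL (List.length_ofFn) ?_
  · intro a ha b hb
    obtain ⟨i, rfl⟩ := List.mem_ofFn.1 ha
    obtain ⟨j, rfl⟩ := List.mem_ofFn.1 hb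
    unfold legLength
    split_ifs <;> omega
  · rw [List.sum_ofFn]
    rcases Nat.eq_zero_or_pos L.length with h0 | h0
    · rw [List.length_eq_zero_iff.1 h0]
      rfl
    · have h1 := sum_legLength m L.length h0
      have h2 : ∑ j, (legLength m L.length j - 1) + ∑ _j : Fin L.length, 1 =
          ∑ j, legLength m L.length j := by
        rw [← Finset.sum_add_distrib]
        exact Finset.sum_congr rfl fun j _ => Nat.sub_add_cancel (hpos j)
      simp only [Finset.sum_const, Finset.card_univ, Fintype.card_fin, smul_eq_mul,
        mul_one] at h2
      omega

theorem rootedIso_BTree (q : ℕ) {L : List ℕ} (hL : ∀ a ∈ L, ∀ b ∈ L, a ≤ b + 1) {n : ℕ}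
    (hn : n = (stretch q (paths L)).size + 1) :
    RootedIso (BTree n L.length (q + 1)) (BRoot n L.length (q + 1))
      (stretch q (paths L)).graph (stretch q (paths L)).root := by
  rw [size_stretch] at hn
  exact rootedIso_prependPath (rootedIso_BST hL (by omega)) q

end RForest

/-! ### Transfer to the Laplacian coefficients and conclusion. -/

theorem nonempty_iso_cycleAttach {g : ℕ} {V W : Fin g → Type*} {T : ∀ i, SimpleGraph (V i)}
    {r : ∀ i, V i} {S : ∀ i, SimpleGraph (W i)} {s : ∀ i, W i}
    (h : ∀ i, RootedIso (T i) (r i) (S i) (s i)) :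
    Nonempty (cycleAttach T r ≃g cycleAttach S s) := by
  choose e he using h
  refine ⟨⟨Equiv.sigmaCongrRight fun i => (e i).toEquiv, ?_⟩⟩
  rintro ⟨i, a⟩ ⟨j, b⟩
  change (cycleAttach S s).Adj ⟨i, e i a⟩ ⟨j, e j b⟩ ↔ _
  by_cases hij : i = j
  · subst hij
    rw [cycleAttach_adj_same, cycleAttach_adj_same, SimpleGraph.Iso.map_adj_iff]
  · rw [cycleAttach_adj_of_ne _ _ hij, cycleAttach_adj_of_ne _ _ hij, ← he i, ← he j,
      (e i).injective.eq_iff, (e j).injective.eq_iff]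

section LapCoeff

variable {V W : Type*} [Fintype V] [Fintype W] {G : SimpleGraph V} {H : SimpleGraph W}

theorem lapLE_of_coeffNonneg (hc : Fintype.card V = Fintype.card W)
    (h : CoeffNonneg (lapPoly H - lapPoly G)) : LapLE G H := by
  refine ⟨hc, fun k hk => ?_⟩
  rw [lapCoeff_eq G hk, lapCoeff_eq H (hc ▸ hk), ← hc]
  have := h (Fintype.card V - k)
  rw [coeff_sub] at this
  omega

theorem lapPoly_eq_of_lapCoeff_eq (hc : Fintype.card V = Fintype.card W)
    (h : ∀ k ≤ Fintype.card V, lapCoeff G k = lapCoeff H k) : lapPoly G = lapPoly H := by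
  ext k
  by_cases hk : k ≤ Fintype.card V
  · have := h (Fintype.card V - k) (Nat.sub_le _ _)
    rwa [lapCoeff_eq G (Nat.sub_le _ _), lapCoeff_eq H (hc ▸ Nat.sub_le _ _), ← hc,
      Nat.sub_sub_self hk] at this
  · rw [coeff_eq_zero_of_natDegree_lt, coeff_eq_zero_of_natDegree_lt]
    · exact (natDegree_lapPoly_le H).trans_lt (by omega)
    · exact (natDegree_lapPoly_le G).trans_lt (by omega)

theorem lapCoeff_iso (e : G ≃g H) {k : ℕ} (hk : k ≤ Fintype.card V) :
    lapCoeff G k = lapCoeff H k := by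
  have hc := Fintype.card_congr e.toEquiv
  rw [lapCoeff_eq G hk, lapCoeff_eq H (hc ▸ hk), lapPoly_iso e, hc]

end LapCoeff

theorem theorem2p5 {g : ℕ} (hg : 3 ≤ g) {V : Fin g → Type*} [∀ i, Fintype (V i)]
    (T : ∀ i, SimpleGraph (V i)) (r : ∀ i, V i) (hT : ∀ i, (T i).IsTree)
    (n l : Fin g → ℕ) (hn : ∀ i, n i = Fintype.card (V i))
    (hl : ∀ i, l i = leafCount (T i) (r i)) :
    ∃ p : Fin g → ℕ,
      (∀ i, 1 ≤ p i ∧ p i + l i ≤ n i) ∧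
      (∃ j, ∀ i, i ≠ j → p i = 1) ∧
      LapLE (cycleAttach (fun i => BTree (n i) (l i) (p i)) (fun i => BRoot (n i) (l i) (p i)))
        (cycleAttach T r) ∧
      ((∀ k ≤ ∑ i, n i,
          lapCoeff (cycleAttach (fun i => BTree (n i) (l i) (p i))
            (fun i => BRoot (n i) (l i) (p i))) k = lapCoeff (cycleAttach T r) k) ↔
        Nonempty (cycleAttach (fun i => BTree (n i) (l i) (p i))
          (fun i => BRoot (n i) (l i) (p i)) ≃g cycleAttach T r)) := by
  obtain ⟨g, rfl⟩ := Nat.exists_eq_add_of_le' hg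
  choose f hf using fun i => RForest.exists_rootedIso_graph _ rfl (T i) (r i) (hT i)
  obtain ⟨f', hsize, hleaves, hbal, hstem, hcmp⟩ := RForest.exists_balanced_family (n := g + 2)
    (by omega) (fun f => lapPoly (cycleAttach (fun i => (f i).graph) fun i => (f i).root))
    RForest.lapPoly_cycleAttach_graph f
  choose q L hq hL hqL using fun i => (hbal i).exists_eq
  have hn' : ∀ i, n i = (f' i).size + 1 := fun i => by
    obtain ⟨e, _⟩ := hf i
    rw [hn, hsize, ← RForest.card_vert, Fintype.card_congr e.toEquiv]
  have hl' : ∀ i, l i = (L i).length := fun i => by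
    rw [hl, ← (hf i).leafCount_eq, RForest.leafCount_graph, ← hleaves, hq]
    rcases hqL i with h | h
    · rw [h, RForest.stretch, RForest.leaves_paths]
    · rw [RForest.leaves_stretch _ (by rw [RForest.leaves_paths]; omega), RForest.leaves_paths]
  have hB : ∀ i, RootedIso (BTree (n i) (l i) (q i + 1)) (BRoot (n i) (l i) (q i + 1))
      (f' i).graph (f' i).root := fun i => by
    have h := RForest.rootedIso_BTree (q i) (hL i) (n := n i) (by rw [← hq]; exact hn' i)
    rwa [← hl', ← hq] at h
  obtain ⟨eB⟩ := nonempty_iso_cycleAttach hB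
  obtain ⟨eT⟩ := nonempty_iso_cycleAttach hf
  have hcT : Fintype.card (Σ i, V i) = ∑ i, n i := by
    rw [Fintype.card_sigma]
    exact Finset.sum_congr rfl fun i _ => (hn i).symm
  have hcB : Fintype.card (Σ i, BVert (n i) (l i) (q i + 1)) = ∑ i, n i := by
    rw [Fintype.card_congr eB.toEquiv, Fintype.card_sigma]
    exact Finset.sum_congr rfl fun i _ => by rw [RForest.card_vert, hn']
  have hc := hcB.trans hcT.symm
  -- A stem with `q i` edges is a path of order `q i + 1`.
  refine ⟨fun i => q i + 1, fun i => ⟨Nat.le_add_left _ _, ?_⟩, ?_, ?_, ?_⟩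
  · have := hn' i
    rw [hq, RForest.size_stretch, RForest.size_paths] at this
    have := hl' i
    change q i + 1 + l i ≤ n i
    omega
  · by_cases h : ∃ j, q j ≠ 0
    · obtain ⟨j, hj⟩ := h
      refine ⟨j, fun i hij => ?_⟩
      by_contra hi
      have hi : q i ≠ 0 := by simpa using hi
      -- By the normal form, a nonzero `q i` comes with at least two legs, so it gives a genuine
      -- stem.
      have hs : ∀ i, q i ≠ 0 → (f' i).HasStem := fun i hi => by
        rw [hq]
        exact RForest.hasStem_stretch hi ((hqL i).resolve_left hi)
      exact hstem i j hij (hs i hi) (hs j hj)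
    · push Not at h
      exact ⟨0, fun i _ => congrArg (· + 1) (h i)⟩
  · apply lapLE_of_coeffNonneg hc
    rw [lapPoly_iso eB, ← lapPoly_iso eT]
    rcases hcmp with h | h
    · rw [h, sub_self]
      exact CoeffNonneg.zero
    · exact h.nonneg
  · rw [← hcB]
    refine ⟨fun h => ?_, fun ⟨e⟩ k hk => lapCoeff_iso e hk⟩
    have h := lapPoly_eq_of_lapCoeff_eq hc h
    rw [lapPoly_iso eB, ← lapPoly_iso eT] at h
    -- Equal coefficients exclude a strict decrease, so the family was never changed.
    rcases hcmp with rfl | hpos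
    · exact ⟨eB.trans eT⟩
    · exact absurd (sub_eq_zero.2 h.symm) hpos.2
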